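/- Let $F$ be Thompson's group of all increasing piecewise linear homeomorphisms of $[0,1]$ with finitely many breakpoints, all of them dyadic rationals, and with all slopes integer powers of $2$. Let $x_0,x_1\in F$ be its standard generators, $$x_0(t)=\begin{cases}t/2,&0\le t\le \frac12\\ t-\frac14,&\frac12\le t\le\frac34\\ 2t-1,&\frac34\le t\le 1\end{cases}\qquad x_1(t)=\begin{cases}t,&0\le t\le\frac12\\ \frac t2+\frac14,&\frac12\le t\le\frac34\\ t-\frac18,&\frac34\le t\le\frac78\\ 2t-1,&\frac78\le t\le1.\end{cases}$$ Let $\mathcal T$ be the space of isomorphism classes of connected pointed oriented graphs with arrows labeled by $x_0,x_1$ in which every vertex has, for each label, exactly one outgoing and one incoming arrow. The metric on $\mathcal T$ is $d((\Gamma,x),(\Delta,y))=2^{-n}$, where $n$ is the largest integer such that the balls of radius $n$ around $x$ and $y$ are isomorphic as marked pointed graphs ($d=0$ if all of them are isomorphic; $n=-1$ if already the balls of radius $0$ are not). The Schreier graph $\Gamma$ of the orbit of $\frac12$ has the points of this orbit (the dyadic rationals in $(0,1)$) as vertices and an arrow labeled $x_i$ from $t$ to $x_i(t)$ for all $t$ and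 $i$. Let $\mathcal C\subset\mathcal T$ be the set of all pointed graphs $(\Gamma,q)$, with $q$ any vertex of $\Gamma$ (graphs of type A), and let $\bar{\mathcal C}$ be its closure. For an infinite binary word $w=w_0w_1\ldots$ let $T_w$ be the set of pairs $\tau=(\ell,v)$ with $\ell\in\mathbb Z$ and $v=v_0v_1\ldots\in\{0,1\}^{\mathbb N}$ such that $v_j=w_{\ell+j}$ for all sufficiently large $j$, and put $\tau b=(\ell-1,bv)$ for $b\in\{0,1\}$. (This is a binary tree without a root, in which the infinite path going up from $(0,w)$ turns left or right according to the letters of $w$.) Let $\tilde\Gamma(w)$ be the graph with vertex set $T_w\times\mathbb Z$, where the vertex $((\ell,v),n)$ is thought of as labeled by $0^n1v$ if $n>0$, by $10v$ if $n=0$, and by $1^{1-n}0v$ if $n<0$, and with the following arrows: - $x_0$: $(\tau,n)\to(\tau,n+1)$ for all $n$; - $x_1$: $(\tau,n)\to(\tau,n)$ for $n>0$, $(\tau,0)\to(\tau0,0)$, $(\tau,-1)\to(\tau1,0)$, and $(\tau,n)\to(\tau,n+1)$ for $n\le-2$. The graphs of type B are the pointed graphs $(\tilde\Gamma(w),p)$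 for all infinite binary words $w$ and all vertices $p$ of $\tilde\Gamma(w)$. The graphs of type C are the two pointed graphs with vertex set $\mathbb Z$, base vertex $0$ and arrows $n\to n+1$ labeled $x_0$, in which the arrows labeled $x_1$ are all loops $n\to n$ in the first graph, and are $n\to n+1$ in the second one. **Proposition.** The Cantor–Bendixson rank of $\bar{\mathcal C}$ (the least number of times one has to remove the isolated points from $\bar{\mathcal C}$ to get a set without isolated points) is equal to $1$. The perfect kernel $\mathcal D$ of $\bar{\mathcal C}$ consists exactly of the graphs of type B and of type C, and $\mathcal D$ is homeomorphic to the Cantor set $\{0,1\}^{\mathbb N}$. -/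

import Mathlib

namespace SchreierF

/-! ### Marked graphs and the space of pointed marked graphs -/

/-- A regular marked graph over the label set `{0, 1}`: an oriented graph whose arrows carry labels
(loops and multiple arrows with different labels are allowed), in which every vertex has, for each
label, exactly one outgoing and exactly one incoming arrow. -/
structure MarkedGraph where
  V : Type
  adj : Fin 2 → V → V → Prop
  out_unique : ∀ s x, ∃! y, adj s x y
  in_unique : ∀ s y, ∃! x, adj s x y

/-- `x` and `y` are joined by an arrow, in one direction or the other. -/
def MarkedGraph.Link (G : MarkedGraph) (x y : G.V) : Prop :=
  ∃ s, G.adj s x y ∨ G.adj s y x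

/-- Any two vertices are joined by an unoriented path. -/
def MarkedGraph.Connected (G : MarkedGraph) : Prop :=
  ∀ x y, Relation.ReflTransGen G.Link x y

/-- A connected regular marked graph with a selected vertex. -/
structure PointedGraph extends MarkedGraph where
  connected : toMarkedGraph.Connected
  base : V

namespace PointedGraph

/-- The set of vertices at (unoriented) distance at most `n` from the base vertex. -/
def ball (Γ : PointedGraph) : ℕ → Set Γ.V
  | 0 => {Γ.base}
  | n + 1 => ball Γ n ∪ {y | ∃ x ∈ ball Γ n, Γ.Link x y}

/-- Isomorphism of pointed marked graphs. -/
def Iso (Γ Δ : PointedGraph) : Prop :=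
  ∃ e : Γ.V ≃ Δ.V, e Γ.base = Δ.base ∧ ∀ s x y, Γ.adj s x y ↔ Δ.adj s (e x) (e y)

/-- The balls of radius `n` around the base vertices are isomorphic as pointed marked graphs. -/
def BallIso (n : ℕ) (Γ Δ : PointedGraph) : Prop :=
  ∃ e : Γ.ball n ≃ Δ.ball n, (∀ x, x.1 = Γ.base → (e x).1 = Δ.base) ∧
    ∀ s x y, Γ.adj s x.1 y.1 ↔ Δ.adj s (e x).1 (e y).1

theorem Iso.refl (Γ : PointedGraph) : Iso Γ Γ := ⟨Equiv.refl _, rfl, fun _ _ _ => Iff.rfl⟩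

theorem Iso.symm {Γ Δ : PointedGraph} : Iso Γ Δ → Iso Δ Γ := by
  rintro ⟨e, hb, he⟩
  exact ⟨e.symm, by rw [← hb]; simp, fun s x y => by simp [he]⟩

theorem Iso.trans {Γ Δ Θ : PointedGraph} : Iso Γ Δ → Iso Δ Θ → Iso Γ Θ := by
  rintro ⟨e, hb, he⟩ ⟨f, hf, hf'⟩
  exact ⟨e.trans f, by simp [hb, hf], fun s x y => by simp [he, hf']⟩

instance setoid : Setoid PointedGraph where
  r := Iso
  iseqv := ⟨Iso.refl, Iso.symm, Iso.trans⟩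

theorem base_mem (Γ : PointedGraph) (n : ℕ) : Γ.base ∈ Γ.ball n := by
  induction n with
  | zero => rfl
  | succ n ih => exact Or.inl ih

theorem ball_mono (Γ : PointedGraph) {m n : ℕ} (h : m ≤ n) : Γ.ball m ⊆ Γ.ball n := by
  induction h with
  | refl => exact subset_rfl
  | step _ ih => exact ih.trans Set.subset_union_left

theorem BallIso.symm {n : ℕ} {Γ Δ : PointedGraph} : BallIso n Γ Δ → BallIso n Δ Γ := by
  rintro ⟨e, hb, he⟩
  refine ⟨e.symm, ?_, fun s x y => by simp [he]⟩
  intro x hx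
  have h1 : e ⟨Γ.base, Γ.base_mem n⟩ = x := Subtype.ext ((hb _ rfl).trans hx.symm)
  rw [← h1]; simp

theorem BallIso.trans {n : ℕ} {Γ Δ Θ : PointedGraph} :
    BallIso n Γ Δ → BallIso n Δ Θ → BallIso n Γ Θ := by
  rintro ⟨e, hb, he⟩ ⟨f, hf, hf'⟩
  exact ⟨e.trans f, fun x hx => by simpa using hf _ (hb x hx), fun s x y => by simp [he, hf']⟩

/-- A map between balls preserving base and arrows sends smaller balls into smaller balls. -/
theorem map_mem_ball {n : ℕ} {Γ Δ : PointedGraph} (e : Γ.ball n → Δ.ball n)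
    (hb : ∀ x, x.1 = Γ.base → (e x).1 = Δ.base)
    (he : ∀ s x y, Γ.adj s x.1 y.1 → Δ.adj s (e x).1 (e y).1) (m : ℕ) (hm : m ≤ n)
    (x : Γ.ball n) (hx : x.1 ∈ Γ.ball m) : (e x).1 ∈ Δ.ball m := by
  induction m generalizing x with
  | zero => exact hb x hx
  | succ m ih =>
    rcases hx with hx | ⟨y, hy, s, h⟩
    · exact Or.inl (ih (by omega) x hx)
    · refine Or.inr ⟨_, ih (by omega) ⟨y, Γ.ball_mono (by omega) hy⟩ hy, s, ?_⟩
      exact h.imp (he s ⟨y, _⟩ x) (he s x ⟨y, _⟩)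

theorem BallIso.mono {m n : ℕ} (hm : m ≤ n) {Γ Δ : PointedGraph} :
    BallIso n Γ Δ → BallIso m Γ Δ := by
  intro h
  obtain ⟨e, hb, he⟩ := h
  obtain ⟨hb', he'⟩ : (∀ x, x.1 = Δ.base → (e.symm x).1 = Γ.base) ∧
      ∀ s x y, Δ.adj s x.1 y.1 → Γ.adj s (e.symm x).1 (e.symm y).1 := by
    refine ⟨fun x hx => ?_, fun s x y => by simp [he]⟩
    have h1 : e ⟨Γ.base, Γ.base_mem n⟩ = x := Subtype.ext ((hb _ rfl).trans hx.symm)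
    rw [← h1]; simp
  refine ⟨⟨fun x => ⟨(e ⟨x.1, Γ.ball_mono hm x.2⟩).1,
      map_mem_ball e hb (fun s x y => (he s x y).1) m hm _ x.2⟩,
    fun x => ⟨(e.symm ⟨x.1, Δ.ball_mono hm x.2⟩).1,
      map_mem_ball e.symm hb' he' m hm _ x.2⟩, fun x => by simp, fun x => by simp⟩, ?_, ?_⟩
  · intro x hx; exact hb _ hx
  · intro s x y; exact he s ⟨x.1, _⟩ ⟨y.1, _⟩

theorem Iso.mem_ball {Γ Δ : PointedGraph} (e : Γ.V ≃ Δ.V) (hb : e Γ.base = Δ.base)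
    (he : ∀ s x y, Γ.adj s x y ↔ Δ.adj s (e x) (e y)) (n : ℕ) (x : Γ.V) :
    x ∈ Γ.ball n ↔ e x ∈ Δ.ball n := by
  induction n generalizing x with
  | zero => simp [ball, ← hb]
  | succ n ih =>
    refine or_congr (ih x) ?_
    constructor
    · rintro ⟨y, hy, s, h⟩
      exact ⟨e y, (ih y).1 hy, s, h.imp (he _ _ _).1 (he _ _ _).1⟩
    · rintro ⟨y, hy, s, h⟩
      refine ⟨e.symm y, (ih _).2 (by simpa using hy), s, ?_⟩
      simpa [he] using h

theorem Iso.ballIso {Γ Δ : PointedGraph} (h : Iso Γ Δ) (n : ℕ) : BallIso n Γ Δ := by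
  obtain ⟨e, hb, he⟩ := h
  exact ⟨e.subtypeEquiv (Iso.mem_ball e hb he n), fun x hx => by simp [hx, hb],
    fun s x y => he s _ _⟩

theorem exists_mem_ball (Γ : PointedGraph) (x : Γ.V) : ∃ n, x ∈ Γ.ball n := by
  induction Γ.connected Γ.base x with
  | refl => exact ⟨0, rfl⟩
  | tail _ h ih =>
    obtain ⟨n, hn⟩ := ih
    exact ⟨n + 1, Or.inr ⟨_, hn, h⟩⟩

/-- Isomorphisms of balls are unique, on common subballs. -/
theorem ball_unique {m n : ℕ} {Γ Δ : PointedGraph}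
    (e : Γ.ball m → Δ.ball m) (f : Γ.ball n → Δ.ball n)
    (hbe : ∀ x, x.1 = Γ.base → (e x).1 = Δ.base) (hbf : ∀ x, x.1 = Γ.base → (f x).1 = Δ.base)
    (he : ∀ s x y, Γ.adj s x.1 y.1 → Δ.adj s (e x).1 (e y).1)
    (hf : ∀ s x y, Γ.adj s x.1 y.1 → Δ.adj s (f x).1 (f y).1)
    (k : ℕ) (hm : k ≤ m) (hn : k ≤ n) (x : Γ.V) (hx : x ∈ Γ.ball k) :
    (e ⟨x, Γ.ball_mono hm hx⟩).1 = (f ⟨x, Γ.ball_mono hn hx⟩).1 := by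
  induction k generalizing x with
  | zero =>
    have hx' : x = Γ.base := hx
    rw [hbe ⟨x, _⟩ hx', hbf ⟨x, _⟩ hx']
  | succ k ih =>
    rcases hx with hx | ⟨y, hy, s, h⟩
    · exact ih (by omega) (by omega) x hx
    · have hxy := ih (by omega) (by omega) y hy
      have hxm : x ∈ Γ.ball m := Γ.ball_mono hm (Or.inr ⟨y, hy, s, h⟩)
      have hxn : x ∈ Γ.ball n := Γ.ball_mono hn (Or.inr ⟨y, hy, s, h⟩)
      have hym : y ∈ Γ.ball m := Γ.ball_mono (by omega) hy
      have hyn : y ∈ Γ.ball n := Γ.ball_mono (by omega) hy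
      rcases h with h | h
      · have h1 := he s ⟨y, hym⟩ ⟨x, hxm⟩ h
        have h2 := hf s ⟨y, hyn⟩ ⟨x, hxn⟩ h
        rw [← hxy] at h2
        exact (Δ.out_unique s _).unique h1 h2
      · have h1 := he s ⟨x, hxm⟩ ⟨y, hym⟩ h
        have h2 := hf s ⟨x, hxn⟩ ⟨y, hyn⟩ h
        rw [← hxy] at h2
        exact (Δ.in_unique s _).unique h1 h2

theorem exists_hom {Γ Δ : PointedGraph} (h : ∀ n, BallIso n Γ Δ) :
    ∃ φ : Γ.V → Δ.V, φ Γ.base = Δ.base ∧ ∀ s x y, Γ.adj s x y → Δ.adj s (φ x) (φ y) := by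
  choose e hb he using h
  choose r hr using Γ.exists_mem_ball
  have key : ∀ x n (hx : x ∈ Γ.ball n), (e (r x) ⟨x, hr x⟩).1 = (e n ⟨x, hx⟩).1 := by
    intro x n hx
    rcases le_total (r x) n with h | h
    · exact ball_unique (e (r x)) (e n) (hb _) (hb _) (fun s x y => (he _ s x y).1)
        (fun s x y => (he _ s x y).1) (r x) le_rfl h x (hr x)
    · exact ball_unique (e (r x)) (e n) (hb _) (hb _) (fun s x y => (he _ s x y).1)
        (fun s x y => (he _ s x y).1) n h le_rfl x hx
  refine ⟨fun x => (e (r x) ⟨x, hr x⟩).1, hb _ _ rfl, fun s x y hxy => ?_⟩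
  have hx := Γ.ball_mono (le_max_left (r x) (r y)) (hr x)
  have hy := Γ.ball_mono (le_max_right (r x) (r y)) (hr y)
  change Δ.adj s (e (r x) ⟨x, hr x⟩).1 (e (r y) ⟨y, hr y⟩).1
  rw [key x _ hx, key y _ hy]
  exact (he _ s ⟨x, hx⟩ ⟨y, hy⟩).1 hxy

theorem hom_eq_id {Γ : PointedGraph} (φ : Γ.V → Γ.V) (hb : φ Γ.base = Γ.base)
    (h : ∀ s x y, Γ.adj s x y → Γ.adj s (φ x) (φ y)) (x : Γ.V) : φ x = x := by
  induction Γ.connected Γ.base x with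
  | refl => exact hb
  | tail _ hl ih =>
    obtain ⟨s, hl | hl⟩ := hl
    · have := h _ _ _ hl
      rw [ih] at this
      exact (Γ.out_unique s _).unique this hl
    · have := h _ _ _ hl
      rw [ih] at this
      exact (Γ.in_unique s _).unique this hl

theorem iso_of_ballIso {Γ Δ : PointedGraph} (h : ∀ n, BallIso n Γ Δ) : Iso Γ Δ := by
  obtain ⟨φ, hφ, hφ'⟩ := exists_hom h
  obtain ⟨ψ, hψ, hψ'⟩ := exists_hom (fun n => (h n).symm)
  have h1 : ∀ x, ψ (φ x) = x := hom_eq_id (fun x => ψ (φ x)) (by rw [hφ, hψ])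
    (fun s x y hxy => hψ' _ _ _ (hφ' _ _ _ hxy))
  have h2 : ∀ x, φ (ψ x) = x := hom_eq_id (fun x => φ (ψ x)) (by rw [hψ, hφ])
    (fun s x y hxy => hφ' _ _ _ (hψ' _ _ _ hxy))
  refine ⟨⟨φ, ψ, h1, h2⟩, hφ, fun s x y => ⟨hφ' s x y, fun hxy => ?_⟩⟩
  have := hψ' _ _ _ hxy
  simpa [h1] using this

end PointedGraph

/-- The space of pointed marked graphs: connected regular marked graphs with a selected vertex, up
to isomorphism. -/
def GraphSpace : Type 1 := Quotient PointedGraph.setoid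

namespace GraphSpace

def mk (Γ : PointedGraph) : GraphSpace := Quotient.mk _ Γ

/-- The balls of radius `n` of two elements of the space are isomorphic. -/
def BallIso (n : ℕ) : GraphSpace → GraphSpace → Prop :=
  Quotient.lift₂ (PointedGraph.BallIso n) (by
    intro a b c d hac hbd
    have h1 := PointedGraph.Iso.ballIso hac n
    have h2 := PointedGraph.Iso.ballIso hbd n
    exact propext ⟨fun h => (h1.symm.trans h).trans h2, fun h => (h1.trans h).trans h2.symm⟩)

theorem BallIso.refl (n : ℕ) (a : GraphSpace) : BallIso n a a := by
  induction a using Quotient.inductionOn with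
  | h Γ => exact PointedGraph.Iso.ballIso (PointedGraph.Iso.refl Γ) n

theorem BallIso.symm {n : ℕ} {a b : GraphSpace} : BallIso n a b → BallIso n b a := by
  induction a, b using Quotient.inductionOn₂ with
  | h Γ Δ => exact PointedGraph.BallIso.symm

theorem BallIso.trans {n : ℕ} {a b c : GraphSpace} :
    BallIso n a b → BallIso n b c → BallIso n a c := by
  induction a, b, c using Quotient.inductionOn₃ with
  | h Γ Δ Θ => exact PointedGraph.BallIso.trans

theorem BallIso.mono {m n : ℕ} (hm : m ≤ n) {a b : GraphSpace} :
    BallIso n a b → BallIso m a b := by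
  induction a, b using Quotient.inductionOn₂ with
  | h Γ Δ => exact PointedGraph.BallIso.mono hm

theorem eq_of_ballIso {a b : GraphSpace} : (∀ n, BallIso n a b) → a = b := by
  induction a, b using Quotient.inductionOn₂ with
  | h Γ Δ => exact fun h => Quotient.sound (PointedGraph.iso_of_ballIso h)

open Classical in
/-- The distance `2 ^ (-n)`, where `n` is the largest integer such that the balls of radius `n` are
isomorphic, that is, where `n + 1` is the least radius for which they are not isomorphic (so `n` is
`-1` if already the balls of radius `0`, a vertex with its loops, differ), and `0` if the balls of
every radius are isomorphic. -/
noncomputable instance : Dist GraphSpace where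
  dist a b := if h : ∃ n, ¬ BallIso n a b then 2 * (1 / 2 : ℝ) ^ Nat.find h else 0

theorem dist_le_iff (a b : GraphSpace) (n : ℕ) :
    dist a b ≤ (1 / 2 : ℝ) ^ n ↔ BallIso n a b := by
  classical
  simp only [dist]
  split_ifs with h
  · have h3 : 2 * (1 / 2 : ℝ) ^ Nat.find h ≤ (1 / 2 : ℝ) ^ n ↔ n + 1 ≤ Nat.find h := by
      rw [← pow_le_pow_iff_right_of_lt_one₀ (a := (1 / 2 : ℝ)) (by norm_num) (by norm_num),
        pow_succ (1 / 2 : ℝ) n]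
      constructor <;> intro h <;> linarith
    rw [h3, Nat.succ_le_iff, Nat.lt_find_iff]
    refine ⟨fun h4 => not_not.1 (h4 n le_rfl), fun h4 m hm => not_not.2 (h4.mono hm)⟩
  · push Not at h
    exact ⟨fun _ => h n, fun _ => by positivity⟩

theorem dist_mem (a b : GraphSpace) :
    dist a b = 0 ∨ dist a b = 2 ∨ ∃ n : ℕ, dist a b = (1 / 2 : ℝ) ^ n := by
  classical
  simp only [dist]
  split_ifs with h
  · right
    rcases Nat.find h with _ | n
    · left; simp
    · right; exact ⟨n, by rw [pow_succ]; ring⟩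
  · simp

theorem dist_nonneg' (a b : GraphSpace) : 0 ≤ dist a b := by
  rcases dist_mem a b with h | h | ⟨n, h⟩ <;> rw [h] <;> positivity

theorem dist_le_two (a b : GraphSpace) : dist a b ≤ 2 := by
  rcases dist_mem a b with h | h | ⟨n, h⟩ <;> rw [h]
  · norm_num
  · exact (pow_le_one₀ (by norm_num) (by norm_num)).trans (by norm_num)

theorem dist_eq_zero_iff (a b : GraphSpace) : dist a b = 0 ↔ ∀ n, BallIso n a b := by
  constructor
  · intro h n
    rw [← dist_le_iff, h]; positivity
  · intro h
    have h1 : ∀ n : ℕ, dist a b ≤ (1 / 2 : ℝ) ^ n := fun n => (dist_le_iff a b n).2 (h n)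
    refine le_antisymm (ge_of_tendsto' (tendsto_pow_atTop_nhds_zero_of_lt_one
      (by norm_num : (0 : ℝ) ≤ 1 / 2) (by norm_num)) h1) (dist_nonneg' a b)

theorem dist_comm' (a b : GraphSpace) : dist a b = dist b a := by
  classical
  have h : ∀ n, BallIso n a b ↔ BallIso n b a := fun n => ⟨BallIso.symm, BallIso.symm⟩
  simp only [dist, h]

theorem dist_ultra (a b c : GraphSpace) : dist a c ≤ max (dist a b) (dist b c) := by
  wlog hw : dist b c ≤ dist a b generalizing a b c
  · have := this c b a (by rw [dist_comm' b a, dist_comm' c b]; exact (not_le.1 hw).le)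
    rwa [dist_comm' c a, dist_comm' c b, dist_comm' b a, max_comm] at this
  rw [max_eq_left hw]
  rcases dist_mem a b with h | h | ⟨n, h⟩
  · have h2 : dist b c = 0 := le_antisymm (h ▸ hw) (dist_nonneg' _ _)
    rw [dist_eq_zero_iff] at h2
    have h' := (dist_eq_zero_iff a b).1 h
    rw [h]
    exact ((dist_eq_zero_iff a c).2 fun n => (h' n).trans (h2 n)).le
  · rw [h]; exact dist_le_two a c
  · have h1 := (dist_le_iff a b n).1 h.le
    have h2 := (dist_le_iff b c n).1 (h ▸ hw)
    rw [h]
    exact (dist_le_iff a c n).2 (h1.trans h2)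

noncomputable instance : MetricSpace GraphSpace where
  dist_self a := (dist_eq_zero_iff a a).2 fun n => BallIso.refl n a
  dist_comm := dist_comm'
  dist_triangle a b c := (dist_ultra a b c).trans
    (max_le_add_of_nonneg (dist_nonneg' a b) (dist_nonneg' b c))
  eq_of_dist_eq_zero {a b} h := eq_of_ballIso ((dist_eq_zero_iff a b).1 h)

end GraphSpace

/-! ### Thompson's group `F` -/

/-- A dyadic rational number. -/
def IsDyadic (t : ℝ) : Prop := ∃ (k : ℤ) (m : ℕ), t = k / 2 ^ m

theorem IsDyadic.sub {s t : ℝ} : IsDyadic s → IsDyadic t → IsDyadic (s - t) := by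
  rintro ⟨k, m, rfl⟩ ⟨l, n, rfl⟩
  exact ⟨k * 2 ^ n - l * 2 ^ m, m + n, by push_cast; rw [pow_add]; field_simp⟩

theorem IsDyadic.zero : IsDyadic 0 := ⟨0, 0, by simp⟩

theorem IsDyadic.add {s t : ℝ} (hs : IsDyadic s) (ht : IsDyadic t) : IsDyadic (s + t) := by
  simpa using hs.sub (IsDyadic.zero.sub ht)

theorem IsDyadic.zpow_mul {t : ℝ} (k : ℤ) : IsDyadic t → IsDyadic (2 ^ k * t) := by
  rintro ⟨l, m, rfl⟩
  rcases le_total 0 k with hk | hk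
  · lift k to ℕ using hk
    exact ⟨2 ^ k * l, m, by push_cast; rw [zpow_natCast]; ring⟩
  · obtain ⟨n, rfl⟩ := Int.exists_eq_neg_ofNat hk
    exact ⟨l, n + m, by rw [zpow_neg, zpow_natCast, pow_add]; field_simp⟩

/-- A strictly increasing homeomorphism of `[0, 1]` that is piecewise linear, with finitely many
breakpoints, all of them dyadic, and slopes that are integer powers of `2`: it is affine with such a
slope on every interval without breakpoints in its interior. (A strictly increasing bijection of
`[0, 1]` is a homeomorphism.) -/
def IsThompson (f : unitInterval ≃o unitInterval) : Prop :=
  ∃ B : Finset unitInterval, (∀ b ∈ B, IsDyadic b) ∧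
    ∀ a b : unitInterval, a ≤ b → (∀ c ∈ B, ¬ (a < c ∧ c < b)) →
      ∃ (k : ℤ) (r : ℝ), ∀ t : unitInterval, a ≤ t → t ≤ b → (f t : ℝ) = 2 ^ k * (t : ℝ) + r

theorem IsThompson.isDyadic {f : unitInterval ≃o unitInterval} (hf : IsThompson f)
    (t : unitInterval) (ht : IsDyadic t) : IsDyadic (f t) := by
  classical
  obtain ⟨B, hB, h⟩ := hf
  have key : ∀ (n : ℕ) (t : unitInterval), IsDyadic t → (B.filter (· < t)).card = n →
      IsDyadic (f t) := by
    intro n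
    induction n using Nat.strong_induction_on with
    | _ n ih =>
      intro t ht hn
      have h0 : (f 0 : ℝ) = 0 := by
        have : f 0 = 0 := f.map_bot
        rw [this]; rfl
      suffices H : ∃ b : unitInterval, b ≤ t ∧ IsDyadic b ∧ IsDyadic (f b) ∧
          ∀ c ∈ B, ¬ (b < c ∧ c < t) by
        obtain ⟨b, hbt, hb, hfb, hc⟩ := H
        obtain ⟨k, r, hk⟩ := h b t hbt hc
        have h1 := hk b le_rfl hbt
        have h2 := hk t hbt le_rfl
        have : (f t : ℝ) = f b + 2 ^ k * ((t : ℝ) - b) := by rw [h1, h2]; ring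
        rw [this]
        exact hfb.add ((ht.sub hb).zpow_mul k)
      rcases (B.filter (· < t)).eq_empty_or_nonempty with he | hne
      · refine ⟨0, unitInterval.nonneg t, IsDyadic.zero, by rw [h0]; exact IsDyadic.zero, ?_⟩
        intro c hc hct
        have : c ∈ B.filter (· < t) := Finset.mem_filter.2 ⟨hc, hct.2⟩
        simp [he] at this
      · obtain ⟨b, hb, hmax⟩ := (B.filter (· < t)).exists_max_image id hne
        rw [Finset.mem_filter] at hb
        refine ⟨b, hb.2.le, hB b hb.1, ih _ ?_ b (hB b hb.1) rfl, ?_⟩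
        · rw [← hn]
          apply Finset.card_lt_card
          refine ⟨fun c hc => ?_, fun hs => ?_⟩
          · rw [Finset.mem_filter] at hc ⊢
            exact ⟨hc.1, hc.2.trans hb.2⟩
          · have := hs (Finset.mem_filter.2 hb)
            simp at this
        · intro c hc hct
          exact absurd (hmax c (Finset.mem_filter.2 ⟨hc, hct.2⟩)) (not_le.2 hct.1)
  exact key _ t ht rfl

theorem IsThompson.one : IsThompson 1 :=
  ⟨∅, by simp, fun a b _ _ => ⟨0, 0, fun t _ _ => by simp [RelIso.one_apply]⟩⟩

theorem IsThompson.inv {f : unitInterval ≃o unitInterval} (hf : IsThompson f) :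
    IsThompson f⁻¹ := by
  classical
  have hd := hf.isDyadic
  obtain ⟨B, hB, h⟩ := hf
  refine ⟨B.image f, ?_, ?_⟩
  · simp only [Finset.mem_image]
    rintro _ ⟨b, hb, rfl⟩
    exact hd b (hB b hb)
  · intro a b hab hc
    obtain ⟨k, r, hk⟩ := h (f.symm a) (f.symm b) (f.symm.monotone hab) (by
      intro c hcB hcab
      refine hc (f c) (Finset.mem_image_of_mem f hcB) ⟨?_, ?_⟩
      · exact f.symm_apply_lt.1 hcab.1
      · exact f.lt_symm_apply.1 hcab.2)
    refine ⟨-k, -(2 ^ (-k) * r), fun t hat htb => ?_⟩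
    have h1 := hk (f.symm t) (f.symm.monotone hat) (f.symm.monotone htb)
    rw [f.apply_symm_apply] at h1
    change ((f.symm t : unitInterval) : ℝ) = _
    rw [h1, zpow_neg]
    field_simp
    ring

theorem IsThompson.mul {f g : unitInterval ≃o unitInterval} (hf : IsThompson f)
    (hg : IsThompson g) : IsThompson (f * g) := by
  classical
  have hd : ∀ t : unitInterval, IsDyadic t → IsDyadic (g.symm t) := hg.inv.isDyadic
  obtain ⟨B, hB, h⟩ := hf
  obtain ⟨C, hC, h'⟩ := hg
  refine ⟨C ∪ B.image g.symm, ?_, ?_⟩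
  · simp only [Finset.mem_image, Finset.mem_union]
    rintro _ (hb | ⟨b, hb, rfl⟩)
    · exact hC _ hb
    · exact hd b (hB b hb)
  · intro a b hab hc
    obtain ⟨k, r, hk⟩ := h' a b hab fun c hcC => hc c (Finset.mem_union_left _ hcC)
    obtain ⟨l, q, hl⟩ := h (g a) (g b) (g.monotone hab) (by
      intro c hcB hcab
      refine hc (g.symm c) (Finset.mem_union_right _ (Finset.mem_image_of_mem _ hcB)) ⟨?_, ?_⟩
      · exact g.lt_symm_apply.2 hcab.1
      · exact g.symm_apply_lt.2 hcab.2)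
    refine ⟨l + k, 2 ^ l * r + q, fun t hat htb => ?_⟩
    have h1 := hl (g t) (g.monotone hat) (g.monotone htb)
    rw [hk t hat htb] at h1
    rw [RelIso.mul_apply, h1, zpow_add₀ (by norm_num)]
    ring

/-- Thompson's group `F`. -/
def thompsonF : Subgroup (unitInterval ≃o unitInterval) where
  carrier := {f | IsThompson f}
  mul_mem' := IsThompson.mul
  one_mem' := IsThompson.one
  inv_mem' := IsThompson.inv

/-- The piecewise formula of the generator `x₀`. -/
noncomputable def x0Fun (t : ℝ) : ℝ :=
  if t ≤ 1 / 2 then t / 2 else if t ≤ 3 / 4 then t - 1 / 4 else 2 * t - 1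

/-- The piecewise formula of the generator `x₁`. -/
noncomputable def x1Fun (t : ℝ) : ℝ :=
  if t ≤ 1 / 2 then t else if t ≤ 3 / 4 then t / 2 + 1 / 4
  else if t ≤ 7 / 8 then t - 1 / 8 else 2 * t - 1

theorem exists_orderIso (f g : ℝ → ℝ) (hf : StrictMono f) (h0 : f 0 = 0) (h1 : f 1 = 1)
    (hfg : ∀ t, f (g t) = t) :
    ∃ e : unitInterval ≃o unitInterval, ∀ t : unitInterval, (e t : ℝ) = f t := by
  have hI : ∀ t, t ∈ unitInterval ↔ f t ∈ unitInterval := by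
    intro t
    constructor
    · rintro ⟨ht0, ht1⟩
      exact ⟨h0 ▸ hf.monotone ht0, h1 ▸ hf.monotone ht1⟩
    · rintro ⟨ht0, ht1⟩
      exact ⟨hf.le_iff_le.1 (h0.symm ▸ ht0), hf.le_iff_le.1 (h1.symm ▸ ht1)⟩
  let φ : unitInterval → unitInterval := fun t => ⟨f t, (hI t).1 t.2⟩
  have hφ : StrictMono φ := fun a b hab => hf hab
  have hs : Function.Surjective φ := fun t =>
    ⟨⟨g t, (hI _).2 (by rw [hfg]; exact t.2)⟩, Subtype.ext (hfg t)⟩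
  exact ⟨hφ.orderIsoOfSurjective φ hs, fun t => rfl⟩

theorem exists_x0 : ∃ e : unitInterval ≃o unitInterval, ∀ t : unitInterval, (e t : ℝ) = x0Fun t := by
  refine exists_orderIso x0Fun
    (fun t => if t ≤ 1 / 4 then 2 * t else if t ≤ 1 / 2 then t + 1 / 4 else (t + 1) / 2) ?_ ?_ ?_ ?_
  · intro a b hab
    simp only [x0Fun]
    split_ifs <;> linarith
  · norm_num [x0Fun]
  · norm_num [x0Fun]
  · intro t
    simp only [x0Fun]
    split_ifs <;> linarith

theorem exists_x1 : ∃ e : unitInterval ≃o unitInterval, ∀ t : unitInterval, (e t : ℝ) = x1Fun t := by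
  refine exists_orderIso x1Fun
    (fun t => if t ≤ 1 / 2 then t else if t ≤ 5 / 8 then 2 * t - 1 / 2
      else if t ≤ 3 / 4 then t + 1 / 8 else (t + 1) / 2) ?_ ?_ ?_ ?_
  · intro a b hab
    simp only [x1Fun]
    split_ifs <;> linarith
  · norm_num [x1Fun]
  · norm_num [x1Fun]
  · intro t
    simp only [x1Fun]
    split_ifs <;> linarith

/-- The homeomorphism of `[0, 1]` given by the formula of `x₀`. -/
noncomputable def x0Iso : unitInterval ≃o unitInterval := exists_x0.choose

/-- The homeomorphism of `[0, 1]` given by the formula of `x₁`. -/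
noncomputable def x1Iso : unitInterval ≃o unitInterval := exists_x1.choose

theorem x0Iso_apply (t : unitInterval) : (x0Iso t : ℝ) = x0Fun t := exists_x0.choose_spec t

theorem x1Iso_apply (t : unitInterval) : (x1Iso t : ℝ) = x1Fun t := exists_x1.choose_spec t

theorem x0Iso_mem : x0Iso ∈ thompsonF := by
  classical
  let p : unitInterval := ⟨1 / 2, by norm_num, by norm_num⟩
  let q : unitInterval := ⟨3 / 4, by norm_num, by norm_num⟩
  refine ⟨{p, q}, ?_, ?_⟩
  · intro b hb
    simp only [Finset.mem_insert, Finset.mem_singleton] at hb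
    rcases hb with rfl | rfl
    · exact ⟨1, 1, by norm_num [p]⟩
    · exact ⟨3, 2, by norm_num [q]⟩
  · intro a b hab hc
    have h1 := hc p (by simp)
    have h2 := hc q (by simp)
    simp only [← Subtype.coe_lt_coe, ← Subtype.coe_le_coe, not_and, not_lt, p, q] at h1 h2 hab
    have hsplit : (b : ℝ) ≤ 1 / 2 ∨ (1 / 2 ≤ (a : ℝ) ∧ (b : ℝ) ≤ 3 / 4) ∨ 3 / 4 ≤ (a : ℝ) := by
      by_cases ha : (a : ℝ) < 1 / 2
      · exact Or.inl (h1 ha)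
      · by_cases ha' : (a : ℝ) < 3 / 4
        · exact Or.inr (Or.inl ⟨not_lt.1 ha, h2 ha'⟩)
        · exact Or.inr (Or.inr (not_lt.1 ha'))
    rcases hsplit with h | ⟨h, h'⟩ | h
    · refine ⟨-1, 0, fun t hat htb => ?_⟩
      rw [← Subtype.coe_le_coe] at hat htb
      rw [x0Iso_apply, x0Fun]
      split_ifs <;> norm_num <;> linarith
    · refine ⟨0, -1 / 4, fun t hat htb => ?_⟩
      rw [← Subtype.coe_le_coe] at hat htb
      rw [x0Iso_apply, x0Fun]
      split_ifs <;> norm_num <;> linarith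
    · refine ⟨1, -1, fun t hat htb => ?_⟩
      rw [← Subtype.coe_le_coe] at hat htb
      rw [x0Iso_apply, x0Fun]
      split_ifs <;> norm_num <;> linarith

theorem x1Iso_mem : x1Iso ∈ thompsonF := by
  classical
  let p : unitInterval := ⟨1 / 2, by norm_num, by norm_num⟩
  let q : unitInterval := ⟨3 / 4, by norm_num, by norm_num⟩
  let r : unitInterval := ⟨7 / 8, by norm_num, by norm_num⟩
  refine ⟨{p, q, r}, ?_, ?_⟩
  · intro b hb
    simp only [Finset.mem_insert, Finset.mem_singleton] at hb
    rcases hb with rfl | rfl | rfl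
    · exact ⟨1, 1, by norm_num [p]⟩
    · exact ⟨3, 2, by norm_num [q]⟩
    · exact ⟨7, 3, by norm_num [r]⟩
  · intro a b hab hc
    have h1 := hc p (by simp)
    have h2 := hc q (by simp)
    have h3 := hc r (by simp)
    simp only [← Subtype.coe_lt_coe, ← Subtype.coe_le_coe, not_and, not_lt, p, q, r]
      at h1 h2 h3 hab
    have hsplit : (b : ℝ) ≤ 1 / 2 ∨ (1 / 2 ≤ (a : ℝ) ∧ (b : ℝ) ≤ 3 / 4) ∨
        (3 / 4 ≤ (a : ℝ) ∧ (b : ℝ) ≤ 7 / 8) ∨ 7 / 8 ≤ (a : ℝ) := by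
      by_cases ha : (a : ℝ) < 1 / 2
      · exact Or.inl (h1 ha)
      · by_cases ha' : (a : ℝ) < 3 / 4
        · exact Or.inr (Or.inl ⟨not_lt.1 ha, h2 ha'⟩)
        · by_cases ha'' : (a : ℝ) < 7 / 8
          · exact Or.inr (Or.inr (Or.inl ⟨not_lt.1 ha', h3 ha''⟩))
          · exact Or.inr (Or.inr (Or.inr (not_lt.1 ha'')))
    rcases hsplit with h | ⟨h, h'⟩ | ⟨h, h'⟩ | h
    · refine ⟨0, 0, fun t hat htb => ?_⟩
      rw [← Subtype.coe_le_coe] at hat htb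
      rw [x1Iso_apply, x1Fun]
      split_ifs <;> norm_num <;> linarith
    · refine ⟨-1, 1 / 4, fun t hat htb => ?_⟩
      rw [← Subtype.coe_le_coe] at hat htb
      rw [x1Iso_apply, x1Fun]
      split_ifs <;> norm_num <;> linarith
    · refine ⟨0, -1 / 8, fun t hat htb => ?_⟩
      rw [← Subtype.coe_le_coe] at hat htb
      rw [x1Iso_apply, x1Fun]
      split_ifs <;> norm_num <;> linarith
    · refine ⟨1, -1, fun t hat htb => ?_⟩
      rw [← Subtype.coe_le_coe] at hat htb
      rw [x1Iso_apply, x1Fun]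
      split_ifs <;> norm_num <;> linarith

/-- The standard generators `x₀`, `x₁` of `F`. -/
noncomputable def gen : Fin 2 → thompsonF := ![⟨x0Iso, x0Iso_mem⟩, ⟨x1Iso, x1Iso_mem⟩]

/-! ### Schreier graphs -/

/-- The Schreier graph of the action of a group `G` on `M` with respect to a pair `S` of generators:
there is an arrow labeled `s` from `x` to `y` if and only if the generator `S s` moves `x` to
`y`. -/
def schreierGraph {G : Type*} [Group G] (S : Fin 2 → G) (M : Type) [MulAction G M] :
    MarkedGraph where
  V := M
  adj s x y := S s • x = y
  out_unique s x := ⟨S s • x, rfl, fun _ h => h.symm⟩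
  in_unique s y := ⟨(S s)⁻¹ • y, smul_inv_smul _ _, fun _ h => by rw [← h, inv_smul_smul]⟩

/-- The point `1 / 2` of `[0, 1]`. -/
noncomputable def half : unitInterval := ⟨1 / 2, by norm_num, by norm_num⟩

/-- The Schreier graph of the action of `F` on the orbit of `1 / 2` with respect to `x₀`, `x₁`. -/
noncomputable def dyadicGraph : MarkedGraph :=
  schreierGraph gen (MulAction.orbit thompsonF half)

theorem mem_orbit_isDyadic (t : MulAction.orbit thompsonF half) :
    IsDyadic (t : unitInterval) ∧ 0 < ((t : unitInterval) : ℝ) ∧ ((t : unitInterval) : ℝ) < 1 := by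
  obtain ⟨t, ⟨f, hf⟩, rfl⟩ := t
  change IsDyadic (f half) ∧ 0 < ((f half : unitInterval) : ℝ) ∧ ((f half : unitInterval) : ℝ) < 1
  refine ⟨IsThompson.isDyadic hf half ⟨1, 1, by norm_num [half]⟩, ?_, ?_⟩
  · have h : f 0 < f half := f.strictMono (by
      rw [← Subtype.coe_lt_coe]; norm_num [half])
    exact lt_of_le_of_lt (f 0).2.1 h
  · have h : f half < f 1 := f.strictMono (by
      rw [← Subtype.coe_lt_coe]; norm_num [half])
    exact lt_of_lt_of_le h (f 1).2.2

theorem exists_link_fwd (t : MulAction.orbit thompsonF half) :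
    ∃ u : MulAction.orbit thompsonF half, dyadicGraph.Link t u ∧ ((u.1 : unitInterval) : ℝ) = x0Fun (t.1 : ℝ) :=
  ⟨gen 0 • t, ⟨0, Or.inl rfl⟩, x0Iso_apply _⟩

theorem exists_link_bwd (t : MulAction.orbit thompsonF half) :
    ∃ u : MulAction.orbit thompsonF half, dyadicGraph.Link t u ∧ x0Fun (u.1 : ℝ) = (t.1 : ℝ) := by
  refine ⟨(gen 0)⁻¹ • t, ⟨0, Or.inr ?_⟩, ?_⟩
  · exact smul_inv_smul (gen 0) t
  · rw [← x0Iso_apply]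
    exact congrArg (fun u : MulAction.orbit thompsonF half => ((u : unitInterval) : ℝ))
      (smul_inv_smul (gen 0) t)

theorem exists_link_bwd1 (t : MulAction.orbit thompsonF half) :
    ∃ u : MulAction.orbit thompsonF half, dyadicGraph.Link t u ∧ x1Fun (u.1 : ℝ) = (t.1 : ℝ) := by
  refine ⟨(gen 1)⁻¹ • t, ⟨1, Or.inr ?_⟩, ?_⟩
  · exact smul_inv_smul (gen 1) t
  · rw [← x1Iso_apply]
    exact congrArg (fun u : MulAction.orbit thompsonF half => ((u : unitInterval) : ℝ))
      (smul_inv_smul (gen 1) t)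

theorem reach_half (h0 : dyadicGraph.V) (hh0 : ((h0.1 : unitInterval) : ℝ) = 1 / 2) (m : ℕ) :
    ∀ (t : dyadicGraph.V) (k : ℤ), 2 ^ m * ((t.1 : unitInterval) : ℝ) = k →
      Relation.ReflTransGen dyadicGraph.Link t h0 := by
  induction m with
  | zero =>
    intro t k hk
    obtain ⟨_, h1, h2⟩ := mem_orbit_isDyadic t
    simp only [pow_zero, one_mul] at hk
    rw [hk] at h1 h2
    have h1' : 0 < k := by exact_mod_cast h1
    have h2' : k < 1 := by exact_mod_cast h2
    omega
  | succ m ih =>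
    have heq : ∀ t : dyadicGraph.V, ((t.1 : unitInterval) : ℝ) = 1 / 2 → t = h0 := fun t ht =>
      Subtype.ext (Subtype.ext (ht.trans hh0.symm))
    have grey : ∀ (t : dyadicGraph.V) (k : ℤ), 2 ^ (m + 1) * ((t.1 : unitInterval) : ℝ) = k →
        1 / 2 ≤ ((t.1 : unitInterval) : ℝ) → ((t.1 : unitInterval) : ℝ) ≤ 3 / 4 →
        Relation.ReflTransGen dyadicGraph.Link t h0 := by
      intro t k hk h1 h2
      rcases eq_or_lt_of_le h1 with h1 | h1
      · rw [heq t h1.symm]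
      rcases eq_or_lt_of_le h2 with h2 | h2
      · obtain ⟨u, hu, hu'⟩ := exists_link_fwd t
        rw [← heq u (by rw [hu', h2]; norm_num [x0Fun])]
        exact Relation.ReflTransGen.single hu
      obtain ⟨u, hu, hu'⟩ := exists_link_bwd1 t
      by_cases h3 : ((t.1 : unitInterval) : ℝ) ≤ 5 / 8
      · have hv : ((u.1 : unitInterval) : ℝ) = 2 * ((t.1 : unitInterval) : ℝ) - 1 / 2 := by
          unfold x1Fun at hu'
          split_ifs at hu' <;> linarith
        obtain _ | m := m
        · exfalso
          norm_num at hk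
          have h4 : (1 : ℝ) < k := by linarith
          have h5 : (k : ℝ) < 2 := by linarith
          have h4' : 1 < k := by exact_mod_cast h4
          have h5' : k < 2 := by exact_mod_cast h5
          omega
        · refine Relation.ReflTransGen.head hu (ih u (k - 2 ^ m) ?_)
          rw [hv]; push_cast; rw [← hk]; ring
      · push Not at h3
        have hv : ((u.1 : unitInterval) : ℝ) = ((t.1 : unitInterval) : ℝ) + 1 / 8 := by
          unfold x1Fun at hu'
          split_ifs at hu' <;> linarith
        obtain ⟨v, hv1, hv2⟩ := exists_link_fwd u
        have hv3 : ((v.1 : unitInterval) : ℝ) = 2 * ((t.1 : unitInterval) : ℝ) - 3 / 4 := by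
          rw [hv2, hv]
          unfold x0Fun
          split_ifs <;> linarith
        obtain _ | _ | m := m
        · exfalso
          norm_num at hk
          have h4 : (1 : ℝ) < k := by linarith
          have h5 : (k : ℝ) < 2 := by linarith
          have h4' : 1 < k := by exact_mod_cast h4
          have h5' : k < 2 := by exact_mod_cast h5
          omega
        · exfalso
          norm_num at hk
          have h4 : (2 : ℝ) < k := by linarith
          have h5 : (k : ℝ) < 3 := by linarith
          have h4' : 2 < k := by exact_mod_cast h4
          have h5' : k < 3 := by exact_mod_cast h5
          omega
        · refine Relation.ReflTransGen.head hu (Relation.ReflTransGen.head hv1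
            (ih v (k - 3 * 2 ^ m) ?_))
          rw [hv3]; push_cast; rw [← hk]; ring
    intro t k hk
    obtain ⟨_, h1, h2⟩ := mem_orbit_isDyadic t
    rcases le_or_gt (3 / 4) ((t.1 : unitInterval) : ℝ) with h3 | h3
    · obtain ⟨u, hu, hu'⟩ := exists_link_fwd t
      refine Relation.ReflTransGen.head hu (ih u (k - 2 ^ m) ?_)
      have hv : ((u.1 : unitInterval) : ℝ) = 2 * ((t.1 : unitInterval) : ℝ) - 1 := by
        rw [hu']
        unfold x0Fun
        split_ifs <;> linarith
      rw [hv]; push_cast; rw [← hk]; ring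
    rcases le_or_gt (1 / 2) ((t.1 : unitInterval) : ℝ) with h4 | h4
    · exact grey t k hk h4 h3.le
    obtain ⟨u, hu, hu'⟩ := exists_link_bwd t
    rcases le_or_gt ((t.1 : unitInterval) : ℝ) (1 / 4) with h5 | h5
    · refine Relation.ReflTransGen.head hu (ih u k ?_)
      have hv : ((u.1 : unitInterval) : ℝ) = 2 * ((t.1 : unitInterval) : ℝ) := by
        unfold x0Fun at hu'
        split_ifs at hu' <;> linarith
      rw [hv, ← hk]; ring
    · have hv : ((u.1 : unitInterval) : ℝ) = ((t.1 : unitInterval) : ℝ) + 1 / 4 := by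
        unfold x0Fun at hu'
        split_ifs at hu' <;> linarith
      obtain _ | m := m
      · exfalso
        norm_num at hk
        have h4 : (0 : ℝ) < k := by linarith
        have h5 : (k : ℝ) < 1 := by linarith
        have h4' : 0 < k := by exact_mod_cast h4
        have h5' : k < 1 := by exact_mod_cast h5
        omega
      · refine Relation.ReflTransGen.head hu (grey u (k + 2 ^ m) ?_ (by linarith) (by linarith))
        rw [hv]; push_cast; rw [← hk]; ring

theorem MarkedGraph.link_symm {G : MarkedGraph} {x y : G.V}
    (h : Relation.ReflTransGen G.Link x y) : Relation.ReflTransGen G.Link y x := by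
  induction h with
  | refl => exact Relation.ReflTransGen.refl
  | tail _ hl ih =>
    obtain ⟨s, hs⟩ := hl
    exact Relation.ReflTransGen.head ⟨s, hs.symm⟩ ih

theorem MarkedGraph.connected_of_reach {G : MarkedGraph} (b : G.V)
    (h : ∀ x, Relation.ReflTransGen G.Link x b) : G.Connected := by
  intro x y
  exact (h x).trans (link_symm (h y))

theorem dyadicGraph_connected : dyadicGraph.Connected := by
  let h0 : dyadicGraph.V := ⟨half, MulAction.mem_orbit_self half⟩
  refine MarkedGraph.connected_of_reach h0 fun t => ?_
  obtain ⟨⟨k, m, hk⟩, -⟩ := mem_orbit_isDyadic t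
  exact reach_half h0 rfl m t k (by
    have hk' : ((t.1 : unitInterval) : ℝ) = k / 2 ^ m := hk
    rw [hk']; field_simp)

/-- Graphs of type A: the pointed Schreier graphs of the dyadic rational numbers in `(0, 1)`, that
is, the Schreier graph of the orbit of `1 / 2` with any of its vertices as the base. -/
noncomputable def typeA : Set GraphSpace :=
  {g | ∃ q : dyadicGraph.V, g = GraphSpace.mk ⟨dyadicGraph, dyadicGraph_connected, q⟩}

/-! ### Graphs of type B -/

/-- The marked graph whose arrows labeled `s` lead from `x` to `σ s x`. -/
def ofPerm {V : Type} (σ : Fin 2 → Equiv.Perm V) : MarkedGraph where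
  V := V
  adj s x y := σ s x = y
  out_unique s x := ⟨σ s x, rfl, fun _ h => h.symm⟩
  in_unique s y := ⟨(σ s).symm y, by simp, fun _ h => by simp [← h]⟩

/-- The grey vertices of the graph of type B with upward path `w`: the binary tree without root in
which an infinite path going up from a vertex of level `0` turns according to the letters of `w`.
A vertex is given by its level `ℓ` and by the sequence `v` of the turns of the infinite path
going up from it, the `j`-th turn leading from level `ℓ + j` to level `ℓ + j + 1`; the paths from
any two vertices merge, so that `v` agrees with `w` from some level on. The label of the vertex is
`10v`. -/
def Tree (w : ℕ → Bool) : Type :=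
  {p : ℤ × (ℕ → Bool) // ∃ N : ℕ, ∀ i j : ℕ, N ≤ i → (i : ℤ) = p.1 + j → p.2 j = w i}

namespace Tree

variable {w : ℕ → Bool}

/-- The vertex right above a vertex. -/
def parent (τ : Tree w) : Tree w :=
  ⟨(τ.1.1 + 1, fun j => τ.1.2 (j + 1)), by
    obtain ⟨N, hN⟩ := τ.2
    exact ⟨N, fun i j hi hij => hN i (j + 1) hi (by push_cast; simp only at hij; omega)⟩⟩

/-- The two vertices right below a vertex. -/
def child (b : Bool) (τ : Tree w) : Tree w :=
  ⟨(τ.1.1 - 1, fun j => Nat.casesOn j b τ.1.2), by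
    obtain ⟨N, hN⟩ := τ.2
    refine ⟨max N τ.1.1.toNat, fun i j hi hij => ?_⟩
    simp only at hij
    have h1 : N ≤ i := le_of_max_le_left hi
    have h2 : τ.1.1.toNat ≤ i := le_of_max_le_right hi
    cases j with
    | zero => exfalso; push_cast at hij; omega
    | succ j => exact hN i j h1 (by push_cast at hij; omega)⟩

theorem parent_child (b : Bool) (τ : Tree w) : (child b τ).parent = τ := by
  apply Subtype.ext
  simp [parent, child]

theorem child_parent (b : Bool) (τ : Tree w) (h : τ.1.2 0 = b) : child b τ.parent = τ := by
  apply Subtype.ext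
  refine Prod.ext (by simp [parent, child]) ?_
  funext j
  cases j with
  | zero => exact h.symm
  | succ j => rfl

end Tree

/-- The arrows labeled `x₀` of a graph of type B. The vertices are the pairs `(τ, n)` of a grey
vertex `τ`, with label `10v`, and an integer `n`: `(τ, 0)` is `τ` itself, `(τ, n)` for `n > 0` is the
black vertex with label `0ⁿ1v`, and `(τ, -n)` for `n > 0` is the white vertex with label
`1ⁿ⁺¹0v`. -/
def treeX0 (w : ℕ → Bool) : Equiv.Perm (Tree w × ℤ) where
  toFun p := (p.1, p.2 + 1)
  invFun p := (p.1, p.2 - 1)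
  left_inv p := by simp
  right_inv p := by simp

/-- The arrows labeled `x₁` of a graph of type B: there are loops at the black vertices, `10v` leads
to the grey vertex `100v` below it, `110v` leads to the grey vertex `101v`, and `111u` leads to
`11u`. -/
def treeX1 (w : ℕ → Bool) : Equiv.Perm (Tree w × ℤ) where
  toFun p := if 0 < p.2 then p else if p.2 = 0 then (p.1.child false, 0)
    else if p.2 = -1 then (p.1.child true, 0) else (p.1, p.2 + 1)
  invFun p := if 0 < p.2 then p else if p.2 = 0 then
      (if p.1.1.2 0 then (p.1.parent, -1) else (p.1.parent, 0))
    else (p.1, p.2 - 1)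
  left_inv := by
    rintro ⟨τ, n⟩
    rcases lt_trichotomy n 0 with h | h | h
    · by_cases h1 : n = -1
      · subst h1
        simp [Tree.parent_child]
        rfl
      · have h2 : ¬ 0 < n := by omega
        have h3 : ¬ n = 0 := by omega
        have h4 : ¬ 0 < n + 1 := by omega
        have h5 : ¬ n + 1 = 0 := by omega
        simp [h1, h2, h3, h4, h5]
    · subst h
      simp [Tree.parent_child]
      rfl
    · simp [h]
  right_inv := by
    rintro ⟨τ, n⟩
    rcases lt_trichotomy n 0 with h | h | h
    · have h2 : ¬ 0 < n := by omega
      have h3 : ¬ n = 0 := by omega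
      have h4 : ¬ 0 < n - 1 := by omega
      have h5 : ¬ n - 1 = 0 := by omega
      have h6 : ¬ n - 1 = -1 := by omega
      simp only [h2, h3, if_false, h4, h5, h6, sub_add_cancel]
    · subst h
      by_cases hb : τ.1.2 0 = true
      · simp [hb, Tree.child_parent true τ hb]
      · have hb' : τ.1.2 0 = false := by simpa using hb
        simp [hb', Tree.child_parent false τ hb']
    · simp [h]

/-- The graph of type B in which an infinite path going up turns left or right according to the
letters of `w`. -/
def treeGraph (w : ℕ → Bool) : MarkedGraph := ofPerm ![treeX0 w, treeX1 w]

theorem treeGraph_reach_zero (w : ℕ → Bool) (τ : Tree w) (n : ℤ) :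
    Relation.ReflTransGen (treeGraph w).Link ((τ, n) : Tree w × ℤ) ((τ, 0) : Tree w × ℤ) := by
  induction n using Int.induction_on with
  | zero => exact Relation.ReflTransGen.refl
  | succ n ih =>
    refine Relation.ReflTransGen.head ⟨0, Or.inr ?_⟩ ih
    rfl
  | pred n ih =>
    refine Relation.ReflTransGen.head ⟨0, Or.inl ?_⟩ ih
    exact (treeX0 w).apply_symm_apply ((τ, -n) : Tree w × ℤ)

theorem treeGraph_reach_parent (w : ℕ → Bool) (τ : Tree w) :
    Relation.ReflTransGen (treeGraph w).Link ((τ, 0) : Tree w × ℤ)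
      ((τ.parent, 0) : Tree w × ℤ) := by
  have h : Relation.ReflTransGen (treeGraph w).Link ((τ, 0) : Tree w × ℤ)
      ((treeX1 w).symm (τ, 0)) :=
    Relation.ReflTransGen.single ⟨1, Or.inr ((treeX1 w).apply_symm_apply _)⟩
  refine h.trans ?_
  have h2 : (treeX1 w).symm (τ, 0) = (τ.parent, ((treeX1 w).symm (τ, 0)).2) := by
    refine Prod.ext ?_ rfl
    change (if (0 : ℤ) < 0 then (τ, (0 : ℤ)) else if (0 : ℤ) = 0 then
      (if τ.1.2 0 then (τ.parent, -1) else (τ.parent, 0)) else (τ, 0 - 1)).1 = τ.parent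
    split_ifs <;> first | rfl | omega
  rw [h2]
  exact treeGraph_reach_zero w _ _

/-- The grey vertex of level `N` on the path `w`. -/
def spine (w : ℕ → Bool) (N : ℕ) : Tree w :=
  ⟨(N, fun j => w (N + j)), 0, fun i j _ hij => by
    have : i = N + j := by simp only at hij; exact_mod_cast hij
    rw [this]⟩

theorem treeGraph_reach_spine (w : ℕ → Bool) (k : ℕ) : ∀ τ : Tree w, ∀ N : ℕ,
    τ.1.1 + k = N → (∀ i j : ℕ, N ≤ i → (i : ℤ) = τ.1.1 + j → τ.1.2 j = w i) →
    Relation.ReflTransGen (treeGraph w).Link ((τ, 0) : Tree w × ℤ)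
      ((spine w N, 0) : Tree w × ℤ) := by
  induction k with
  | zero =>
    intro τ N h hN
    have : τ = spine w N := by
      apply Subtype.ext
      refine Prod.ext (by simpa [spine] using h) ?_
      funext j
      exact hN (N + j) j (by omega) (by push_cast; simp at h; omega)
    rw [this]
    exact Relation.ReflTransGen.refl
  | succ k ih =>
    intro τ N h hN
    refine (treeGraph_reach_parent w τ).trans (ih τ.parent N ?_ ?_)
    · simp only [Tree.parent]; push_cast at h; omega
    · intro i j hi hij
      exact hN i (j + 1) hi (by simp only [Tree.parent] at hij; push_cast; omega)

theorem treeGraph_connected (w : ℕ → Bool) : (treeGraph w).Connected := by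
  refine MarkedGraph.connected_of_reach (G := treeGraph w) ((spine w 0, 0) : Tree w × ℤ) ?_
  rintro ⟨τ, n⟩
  refine (treeGraph_reach_zero w τ n).trans ?_
  obtain ⟨N, hN⟩ := τ.2
  have h1 := treeGraph_reach_spine w (max (N : ℤ) τ.1.1 - τ.1.1).toNat τ (max (N : ℤ) τ.1.1).toNat
    (by omega) (fun i j hi hij => hN i j (by omega) hij)
  have h2 := treeGraph_reach_spine w (max (N : ℤ) τ.1.1).toNat (spine w 0)
    (max (N : ℤ) τ.1.1).toNat (by simp [spine]) (fun i j hi hij => by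
      have : i = j := by simp [spine] at hij; omega
      simp [spine, this])
  refine h1.trans ?_
  exact MarkedGraph.link_symm h2

/-- Graphs of type B, with any vertex as the base. -/
def typeB : Set GraphSpace :=
  {g | ∃ (w : ℕ → Bool) (x : (treeGraph w).V),
    g = GraphSpace.mk ⟨treeGraph w, treeGraph_connected w, x⟩}

/-! ### Graphs of type C -/

/-- The line with vertices the integers, with arrows labeled `x₀` from `n` to `n + 1` and arrows
labeled `x₁` from `n` to `n + d`: for `d = 0` the `x₁`-arrows are loops, as at the black vertices,
and for `d = 1` they are parallel to the `x₀`-arrows, as at the white vertices. -/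
def lineGraph (d : ℤ) : MarkedGraph := ofPerm ![Equiv.addRight 1, Equiv.addRight d]

theorem lineGraph_connected (d : ℤ) : (lineGraph d).Connected := by
  refine MarkedGraph.connected_of_reach (G := lineGraph d) (0 : ℤ) fun n => ?_
  change ℤ at n
  induction n using Int.induction_on with
  | zero => exact Relation.ReflTransGen.refl
  | succ n ih =>
    refine Relation.ReflTransGen.head ⟨0, Or.inr ?_⟩ ih
    rfl
  | pred n ih =>
    refine Relation.ReflTransGen.head ⟨0, Or.inl ?_⟩ ih
    exact sub_add_cancel (-(n : ℤ)) 1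

/-- The two graphs of type C (all choices of the base vertex are isomorphic). -/
def typeC : Set GraphSpace :=
  {GraphSpace.mk ⟨lineGraph 0, lineGraph_connected 0, (0 : ℤ)⟩,
    GraphSpace.mk ⟨lineGraph 1, lineGraph_connected 1, (0 : ℤ)⟩}

/-! ### Cantor–Bendixson rank -/

/-- The Cantor–Bendixson rank: the least ordinal number of times one has to remove the isolated
points of `s` to get a set without isolated points. -/
noncomputable def cantorBendixsonRank {X : Type*} [TopologicalSpace X] (s : Set X) : Ordinal :=
  sInf {a | Preperfect (CantorBendixson.iteratedDerivedSet s a)}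

end SchreierF

/-!
A bijection `T ≃ {0, 1} × T` gives every node `τ` of `T` two children and one parent, and defines a
marked graph on `T × ℤ`: `x₀` shifts the integer, and `x₁` moves to a child next to the integer `0`.
The graphs of type B arise from trees without a root; the Schreier graph arises from the dyadic
rationals in `[0, 1)`, the parent of `t` being `2t` modulo `1`. The ball of radius `N` around
`(τ, n)` is determined by `n` and by the directions of the first `N + 1` steps up from `τ`, as long
as no node recurs on the way up, and if `|n|` is large, it is a ball of a graph of type C.

In the Schreier graph every way up ends at the fixed point `0`, but for all except finitely many
vertices `|n|` is large or this takes many steps. Hence, far out, the graph of type A based at a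
vertex is close to the graph of type B based at a vertex with the same label. The graphs of types B
and C depend continuously and injectively on the label of the base vertex, so they form a Cantor
set, in which those with a label from the Schreier graph are dense. No graph of type A lies in this
set: because of the fixed point it has parallel arrows with both labels whose common end is taken by
`x₀` to a vertex with an `x₁`-loop. Thus the derived set of the graphs of type A is the Cantor set.
-/

namespace SchreierF

/-! ### Derived sets and Cantor–Bendixson rank -/

section Topology

open Filter Topology

theorem mapClusterPt_cofinite_of_accPt {X ι : Type*} [TopologicalSpace X] [T1Space X] {x : X}
    {f : ι → X} (h : AccPt x (𝓟 (Set.range f))) : MapClusterPt x cofinite f := by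
  refine mapClusterPt_iff_frequently.2 fun U hU => frequently_cofinite_iff_infinite.2 fun hfin => ?_
  refine Set.Infinite.of_accPt (h.nhds_inter hU) ((hfin.image f).subset ?_)
  rintro _ ⟨hi, i, rfl⟩
  exact ⟨i, hi, rfl⟩

theorem accPt_of_mapClusterPt {X ι : Type*} [TopologicalSpace X] {x : X} {l : Filter ι} {f : ι → X}
    (h : MapClusterPt x l f) (hne : ∀ i, f i ≠ x) : AccPt x (𝓟 (Set.range f)) := by
  refine accPt_iff_nhds.2 fun U hU => ?_
  obtain ⟨i, hi⟩ := (h.frequently hU).exists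
  exact ⟨f i, ⟨hi, Set.mem_range_self i⟩, hne i⟩

theorem mapClusterPt_iff_of_tendsto_dist {X ι : Type*} [PseudoMetricSpace X] {x : X}
    {l : Filter ι} {f g : ι → X} (h : Tendsto (fun i => dist (f i) (g i)) l (𝓝 0)) :
    MapClusterPt x l f ↔ MapClusterPt x l g := by
  simp only [mapClusterPt_iff_ultrafilter]
  exact exists_congr fun u => and_congr_right fun hu => tendsto_iff_of_dist (h.mono_left hu)

theorem derivedSet_range_eq_of_tendsto_dist {X ι : Type*} [MetricSpace X] {f g : ι → X} {K : Set X}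
    (h : Tendsto (fun i => dist (f i) (g i)) cofinite (𝓝 0)) (hg : closure (Set.range g) = K)
    (hK : Preperfect K) (hf : ∀ i, f i ∉ K) : derivedSet (Set.range f) = K := by
  apply Set.Subset.antisymm
  · intro x hx
    have hxg := (mapClusterPt_iff_of_tendsto_dist h).1 (mapClusterPt_cofinite_of_accPt hx)
    refine (hg ▸ isClosed_closure : IsClosed K).mem_of_mapClusterPt hxg (.of_forall fun i => ?_)
    exact hg ▸ subset_closure (Set.mem_range_self i)
  · intro x hx
    have hxg : x ∈ derivedSet (Set.range g) := by
      rw [← derivedSet_closure, hg]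
      exact hK x hx
    exact accPt_of_mapClusterPt
      ((mapClusterPt_iff_of_tendsto_dist h).2 (mapClusterPt_cofinite_of_accPt hxg))
      fun i hi => hf i (hi ▸ hx)

theorem perfectSpace_pi {ι : Type*} [Infinite ι] {X : ι → Type*} [∀ i, TopologicalSpace (X i)]
    [∀ i, Nontrivial (X i)] : PerfectSpace (∀ i, X i) := by
  classical
  refine ⟨preperfect_iff_nhds.2 fun x _ U hU => ?_⟩
  choose y hy using fun i => exists_ne (x i)
  have hlim : Tendsto (fun i => Function.update x i (y i)) cofinite (𝓝 x) := by
    refine tendsto_pi_nhds.2 fun j => tendsto_nhds_of_eventually_eq ?_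
    filter_upwards [(Set.finite_singleton j).compl_mem_cofinite] with i hi
    exact Function.update_of_ne (Ne.symm hi) _ _
  obtain ⟨i, hi⟩ := (hlim.eventually_mem hU).exists
  exact ⟨_, ⟨hi, trivial⟩, Function.update_ne_self_iff.2 (hy i)⟩

theorem preperfect_range {X Y : Type*} [TopologicalSpace X] [PerfectSpace X] [TopologicalSpace Y]
    {f : X → Y} (hf : Continuous f) (hinj : Function.Injective f) : Preperfect (Set.range f) := by
  rw [preperfect_iff_subset_derivedSet, ← Set.image_univ]
  exact (Set.image_mono (preperfect_iff_subset_derivedSet.1 PerfectSpace.univ_preperfect)).trans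
    (hf.image_derivedSet hinj)

section CantorBendixson

open CantorBendixson

variable {X : Type*} [TopologicalSpace X] [T1Space X] {s : Set X}

theorem iteratedDerivedSet_closure_one (s : Set X) :
    iteratedDerivedSet (closure s) 1 = derivedSet s := by
  rw [← zero_add (1 : Ordinal), iteratedDerivedSet_succ, iteratedDerivedSet_zero,
    isClosed_closure.relDerivedSet_eq, derivedSet_closure]

theorem perfectKernel_closure (h : Preperfect (derivedSet s)) :
    perfectKernel (closure s) = derivedSet s := by
  rw [← iteratedDerivedSet_closure_one s] at h ⊢
  exact perfectKernel_eq_iteratedDerivedSet_of_mem_fixedPoints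
    (preperfect_iff_eq_relDerivedSet.1 h).symm

theorem cantorBendixsonRank_closure (h : Preperfect (derivedSet s)) (hs : ¬s ⊆ derivedSet s) :
    cantorBendixsonRank (closure s) = 1 := by
  rw [← iteratedDerivedSet_closure_one s] at h
  refine le_antisymm (csInf_le' h) (le_csInf ⟨1, h⟩ fun a ha => ?_)
  rw [Order.one_le_iff_pos, pos_iff_ne_zero]
  rintro rfl
  rw [Set.mem_ofPred_eq, iteratedDerivedSet_zero, preperfect_iff_subset_derivedSet,
    derivedSet_closure] at ha
  exact hs (subset_closure.trans ha)

end CantorBendixson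

end Topology

/-! ### Local isomorphisms of marked graphs -/

theorem surjective_of_map_adj {G H : MarkedGraph} (x₀ : G.V) (hH : H.Connected) (φ : G.V → H.V)
    (hφ : ∀ s x y, G.adj s x y → H.adj s (φ x) (φ y)) : Function.Surjective φ := by
  intro y
  induction hH (φ x₀) y with
  | refl => exact ⟨x₀, rfl⟩
  | tail _ hl ih =>
    obtain ⟨x, rfl⟩ := ih
    obtain ⟨s, hl | hl⟩ := hl
    · obtain ⟨x', hx', -⟩ := G.out_unique s x
      exact ⟨x', (H.out_unique s _).unique (hφ s x x' hx') hl⟩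
    · obtain ⟨x', hx', -⟩ := G.in_unique s x
      exact ⟨x', (H.in_unique s _).unique (hφ s x' x hx') hl⟩

theorem PointedGraph.iso_of_injective {Γ Δ : PointedGraph} (φ : Γ.V → Δ.V)
    (hinj : Function.Injective φ) (hbase : φ Γ.base = Δ.base)
    (hφ : ∀ s x y, Γ.adj s x y → Δ.adj s (φ x) (φ y)) : Iso Γ Δ := by
  refine ⟨Equiv.ofBijective φ ⟨hinj, surjective_of_map_adj Γ.base Δ.connected φ hφ⟩, hbase,
    fun s x y => ⟨hφ s x y, fun h => ?_⟩⟩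
  obtain ⟨y', hy', -⟩ := Γ.out_unique s x
  rwa [hinj ((Δ.out_unique s _).unique h (hφ s x y' hy'))]

/-- A back-and-forth system between two marked graphs: a decreasing sequence of relations, the first
of which is a partial bijection, such that traversing an arrow with a given label, on both sides and
in either direction, lowers the index by one. If `R k` relates two vertices, then the balls of
radius `k - 1` around them are isomorphic. -/
structure BackAndForth (G H : MarkedGraph) (R : ℕ → G.V → H.V → Prop) : Prop where
  mono : ∀ k x y, R (k + 1) x y → R k x y
  fwd : ∀ k s x y x' y', R (k + 1) x y → G.adj s x x' → H.adj s y y' → R k x' y'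
  bwd : ∀ k s x y x' y', R (k + 1) x y → G.adj s x' x → H.adj s y' y → R k x' y'
  eq_iff_eq : ∀ x y x' y', R 0 x y → R 0 x' y' → (x = x' ↔ y = y')

namespace BackAndForth

variable {G H : MarkedGraph} {R : ℕ → G.V → H.V → Prop}

theorem swap (h : BackAndForth G H R) : BackAndForth H G (fun k y x => R k x y) where
  mono k y x := h.mono k x y
  fwd k s y x y' x' hR h₁ h₂ := h.fwd k s x y x' y' hR h₂ h₁
  bwd k s y x y' x' hR h₁ h₂ := h.bwd k s x y x' y' hR h₂ h₁
  eq_iff_eq y x y' x' h₁ h₂ := (h.eq_iff_eq x y x' y' h₁ h₂).symm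

theorem rel_of_le (h : BackAndForth G H R) {m n : ℕ} (hmn : m ≤ n) {x : G.V} {y : H.V}
    (hR : R n x y) : R m x y := by
  induction n, hmn using Nat.le_induction with
  | base => exact hR
  | succ n _ ih => exact ih (h.mono n x y hR)

theorem adj_iff_adj (h : BackAndForth G H R) {s : Fin 2} {x x' : G.V} {y y' : H.V}
    (hR : R 1 x y) (hR' : R 0 x' y') : G.adj s x x' ↔ H.adj s y y' := by
  obtain ⟨x₁, hx₁, -⟩ := G.out_unique s x
  obtain ⟨y₁, hy₁, -⟩ := H.out_unique s y
  have hx : G.adj s x x' ↔ x₁ = x' :=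
    ⟨fun hx' => (G.out_unique s x).unique hx₁ hx', fun hx' => hx' ▸ hx₁⟩
  have hy : H.adj s y y' ↔ y₁ = y' :=
    ⟨fun hy' => (H.out_unique s y).unique hy₁ hy', fun hy' => hy' ▸ hy₁⟩
  rw [hx, hy]
  exact h.eq_iff_eq x₁ y₁ x' y' (h.fwd 0 s x y x₁ y₁ hR hx₁ hy₁) hR'

end BackAndForth

namespace PointedGraph

variable {Γ Δ : PointedGraph} {R : ℕ → Γ.V → Δ.V → Prop}

theorem exists_rel_of_mem_ball (h : BackAndForth Γ.toMarkedGraph Δ.toMarkedGraph R) {m k : ℕ}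
    (hbase : R (m + k) Γ.base Δ.base) {x : Γ.V} (hx : x ∈ Γ.ball k) : ∃ y ∈ Δ.ball k, R m x y := by
  induction k generalizing m x with
  | zero =>
    obtain rfl : x = Γ.base := hx
    exact ⟨Δ.base, rfl, hbase⟩
  | succ k ih =>
    rw [← add_assoc, add_right_comm] at hbase
    obtain hx | ⟨x₀, hx₀, s, hs | hs⟩ := hx
    · obtain ⟨y, hy, hxy⟩ := ih hbase hx
      exact ⟨y, Or.inl hy, h.mono _ _ _ hxy⟩
    · obtain ⟨y, hy, hxy⟩ := ih hbase hx₀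
      obtain ⟨y', hy', -⟩ := Δ.out_unique s y
      exact ⟨y', Or.inr ⟨y, hy, s, Or.inl hy'⟩, h.fwd _ _ _ _ _ _ hxy hs hy'⟩
    · obtain ⟨y, hy, hxy⟩ := ih hbase hx₀
      obtain ⟨y', hy', -⟩ := Δ.in_unique s y
      exact ⟨y', Or.inr ⟨y, hy, s, Or.inr hy'⟩, h.bwd _ _ _ _ _ _ hxy hs hy'⟩

theorem ballIso_of_backAndForth (h : BackAndForth Γ.toMarkedGraph Δ.toMarkedGraph R) {n : ℕ}
    (hbase : R (n + 1) Γ.base Δ.base) : BallIso n Γ Δ := by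
  rw [add_comm] at hbase
  choose f hf hR using fun x (hx : x ∈ Γ.ball n) => exists_rel_of_mem_ball h hbase hx
  have huniq : ∀ {x y x' y'}, R 1 x y → R 1 x' y' → (x = x' ↔ y = y') := fun h₁ h₂ =>
    h.eq_iff_eq _ _ _ _ (h.mono 0 _ _ h₁) (h.mono 0 _ _ h₂)
  let φ : Γ.ball n → Δ.ball n := fun x => ⟨f x.1 x.2, hf x.1 x.2⟩
  have hinj : Function.Injective φ := fun x x' hxx' =>
    Subtype.ext ((huniq (hR _ x.2) (hR _ x'.2)).2 (congrArg Subtype.val hxx'))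
  have hsurj : Function.Surjective φ := by
    rintro ⟨y, hy⟩
    obtain ⟨x, hx, hxy⟩ := exists_rel_of_mem_ball h.swap hbase hy
    exact ⟨⟨x, hx⟩, Subtype.ext ((huniq (hR x hx) hxy).1 rfl)⟩
  exact ⟨Equiv.ofBijective φ ⟨hinj, hsurj⟩,
    fun x hx => (huniq (hR _ x.2) (h.rel_of_le (by omega) hbase)).1 hx,
    fun s x y => h.adj_iff_adj (hR _ x.2) (h.mono _ _ _ (hR _ y.2))⟩

end PointedGraph

section OfPerm

variable {V W : Type} {σ : Fin 2 → Equiv.Perm V} {ρ : Fin 2 → Equiv.Perm W}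

theorem backAndForth_ofPerm {R : ℕ → V → W → Prop} (mono : ∀ k x y, R (k + 1) x y → R k x y)
    (fwd : ∀ k s x y, R (k + 1) x y → R k (σ s x) (ρ s y))
    (bwd : ∀ k s x y, R (k + 1) x y → R k ((σ s).symm x) ((ρ s).symm y))
    (eq_iff_eq : ∀ x y x' y', R 0 x y → R 0 x' y' → (x = x' ↔ y = y')) :
    BackAndForth (ofPerm σ) (ofPerm ρ) R where
  mono := mono
  eq_iff_eq := eq_iff_eq
  fwd k s x y x' y' hR hx hy := by
    obtain rfl : σ s x = x' := hx
    obtain rfl : ρ s y = y' := hy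
    exact fwd k s x y hR
  bwd k s x y x' y' hR hx hy := by
    obtain rfl : x' = (σ s).symm x := (σ s).eq_symm_apply.2 hx
    obtain rfl : y' = (ρ s).symm y := (ρ s).eq_symm_apply.2 hy
    exact bwd k s x y hR

theorem iso_ofPerm_iff (hσ : (ofPerm σ).Connected) (hρ : (ofPerm ρ).Connected) (x : V) (y : W) :
    PointedGraph.Iso ⟨ofPerm σ, hσ, x⟩ ⟨ofPerm ρ, hρ, y⟩ ↔
      ∃ φ : V ≃ W, φ x = y ∧ ∀ s, Function.Semiconj φ (σ s) (ρ s) := by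
  refine exists_congr fun (φ : V ≃ W) => and_congr_right fun _ => forall_congr' fun s => ?_
  change (∀ z z' : V, σ s z = z' ↔ ρ s (φ z) = φ z') ↔ _
  refine ⟨fun h z => ((h z _).1 rfl).symm, fun h z z' => ?_⟩
  rw [← h z, φ.apply_eq_iff_eq]

theorem semiconj_zpow {f : V → W} {σ : Equiv.Perm V} {ρ : Equiv.Perm W}
    (h : Function.Semiconj f σ ρ) (j : ℤ) : Function.Semiconj f ⇑(σ ^ j) ⇑(ρ ^ j) := by
  have hinv : Function.Semiconj f ⇑σ⁻¹ ⇑ρ⁻¹ :=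
    h.inverses_right σ.apply_symm_apply ρ.symm_apply_apply
  induction j using Int.induction_on with
  | zero => simp [Function.Semiconj.id_right]
  | succ j ih =>
    rw [zpow_add_one, zpow_add_one]
    exact ih.comp_right h
  | pred j ih =>
    rw [zpow_sub_one, zpow_sub_one]
    exact ih.comp_right hinv

theorem ballIso_lineGraph (hσ : (ofPerm σ).Connected) {n : ℕ} {d : ℤ} (hd : |d| ≤ 1) {f : ℤ → V}
    (hf : Function.Injective f) (h₀ : ∀ j, σ 0 (f j) = f (j + 1))
    (h₁ : ∀ j : ℤ, |j| ≤ n + 1 → σ 1 (f j) = f (j + d)) :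
    PointedGraph.BallIso n ⟨ofPerm σ, hσ, f 0⟩ ⟨lineGraph d, lineGraph_connected d, (0 : ℤ)⟩ := by
  refine PointedGraph.ballIso_of_backAndForth
    (R := fun k (x : V) (j : ℤ) => x = f j ∧ |j| + k ≤ n + 1)
    (backAndForth_ofPerm ?_ ?_ ?_ ?_) ⟨rfl, by simp⟩
  · rintro k x j ⟨rfl, hj⟩
    exact ⟨rfl, by push_cast at hj; omega⟩
  · rintro k s x j ⟨rfl, hj⟩
    push_cast at hj
    fin_cases s
    · exact ⟨h₀ j, by change |j + 1| + (k : ℤ) ≤ n + 1; grind⟩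
    · exact ⟨h₁ j (by omega), by change |j + d| + (k : ℤ) ≤ n + 1; grind⟩
  · rintro k s x j ⟨rfl, hj⟩
    push_cast at hj
    rw [Equiv.symm_apply_eq]
    fin_cases s
    · exact ⟨by simp [h₀], by change |j + -1| + (k : ℤ) ≤ n + 1; grind⟩
    · have hjd : |j - d| + (k : ℤ) ≤ n + 1 := by grind
      refine ⟨?_, hjd⟩
      change f j = σ 1 (f (j - d))
      rw [h₁ (j - d) (by omega), sub_add_cancel]
  · rintro x j x' j' ⟨rfl, -⟩ ⟨rfl, -⟩
    exact hf.eq_iff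

end OfPerm

/-! ### Graphs of binary splittings -/

/-- A binary splitting of `T`: every element of `T` has a letter and a parent, and is determined by
them, while all pairs occur. Both the tree without root of a graph of type B and the dyadic
subdivision of `[0, 1)` are of this kind. -/
abbrev Splitting (T : Type) := T ≃ Bool × T

namespace Splitting

variable {T T' : Type} (e : Splitting T) (e' : Splitting T')

/-- The parent of an element. -/
def parent (τ : T) : T := (e τ).2

/-- The element with a given letter and a given parent. -/
def child (b : Bool) (τ : T) : T := e.symm (b, τ)

/-- The sequence of the letters met on the way up from an element. -/
def word (τ : T) (j : ℕ) : Bool := (e (e.parent^[j] τ)).1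

@[simp]
theorem parent_child (b : Bool) (τ : T) : e.parent (e.child b τ) = τ := by
  simp [parent, child]

@[simp]
theorem word_child_zero (b : Bool) (τ : T) : e.word (e.child b τ) 0 = b := by
  simp [word, child]

theorem child_word_zero_parent (τ : T) : e.child (e.word τ 0) (e.parent τ) = τ :=
  e.symm_apply_apply τ

theorem word_parent (τ : T) (j : ℕ) : e.word (e.parent τ) j = e.word τ (j + 1) := rfl

@[simp]
theorem word_child_succ (b : Bool) (τ : T) (j : ℕ) : e.word (e.child b τ) (j + 1) = e.word τ j := by
  rw [← word_parent, parent_child]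

theorem eq_of_iterate_parent_eq {j : ℕ} {τ υ : T} (h : e.parent^[j] τ = e.parent^[j] υ)
    (hword : ∀ a < j, e.word τ a = e.word υ a) : τ = υ := by
  induction j generalizing τ υ with
  | zero => exact h
  | succ j ih =>
    have hparent : e.parent τ = e.parent υ := ih h fun a ha => hword (a + 1) (by omega)
    rw [← e.child_word_zero_parent τ, ← e.child_word_zero_parent υ, hparent, hword 0 (by omega)]

/-- The `x₀`-arrows: a shift along the second coordinate. -/
def x0 (T : Type) : Equiv.Perm (T × ℤ) := (Equiv.refl T).prodCongr (Equiv.addRight 1)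

/-- The `x₁`-arrows: with `T` in place of the tree, the formulas are those of a graph of
type B. -/
def x1 : Equiv.Perm (T × ℤ) where
  toFun p := if 0 < p.2 then p else if p.2 = 0 then (e.child false p.1, 0)
    else if p.2 = -1 then (e.child true p.1, 0) else (p.1, p.2 + 1)
  invFun p := if 0 < p.2 then p else if p.2 = 0 then
      (if e.word p.1 0 then (e.parent p.1, -1) else (e.parent p.1, 0))
    else (p.1, p.2 - 1)
  left_inv := by
    rintro ⟨τ, n⟩
    obtain h | rfl | rfl | h : 0 < n ∨ n = 0 ∨ n = -1 ∨ n < -1 := by omega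
    · simp [h]
    · simp
    · simp
    · grind
  right_inv := by
    rintro ⟨τ, n⟩
    obtain h | rfl | h : 0 < n ∨ n = 0 ∨ n < 0 := by omega
    · simp [h]
    · have := e.child_word_zero_parent τ
      cases hb : e.word τ 0 <;> simp_all
    · grind

/-- The marked graph with vertex set `T × ℤ` defined by a splitting of `T`. -/
def graph : MarkedGraph := ofPerm ![x0 T, e.x1]

theorem x0_apply (p : T × ℤ) : x0 T p = (p.1, p.2 + 1) := rfl

theorem x0_zpow_apply (j : ℤ) (p : T × ℤ) : (x0 T ^ j) p = (p.1, p.2 + j) := by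
  have hsnd : ((x0 T ^ j) p).2 = p.2 + j := by
    have := semiconj_zpow (f := Prod.snd) (σ := x0 T) (ρ := Equiv.addRight 1) (fun _ => rfl) j p
    simpa using this
  have hfst : ((x0 T ^ j) p).1 = p.1 := by
    have := semiconj_zpow (f := Prod.fst) (σ := x0 T) (ρ := 1) (fun _ => rfl) j p
    simpa using this
  exact Prod.ext hfst hsnd

theorem x1_of_pos {n : ℤ} (h : 0 < n) (τ : T) : e.x1 (τ, n) = (τ, n) := if_pos h

theorem x1_zero (τ : T) : e.x1 (τ, 0) = (e.child false τ, 0) := rfl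

theorem x1_neg_one (τ : T) : e.x1 (τ, -1) = (e.child true τ, 0) := rfl

theorem x1_of_lt {n : ℤ} (h : n < -1) (τ : T) : e.x1 (τ, n) = (τ, n + 1) := by
  simp [x1, show ¬0 < n by omega, show n ≠ 0 by omega, show n ≠ -1 by omega]

theorem x1_symm_of_pos {n : ℤ} (h : 0 < n) (τ : T) : e.x1.symm (τ, n) = (τ, n) := if_pos h

theorem x1_symm_zero (τ : T) : e.x1.symm (τ, 0) = (e.parent τ, if e.word τ 0 then -1 else 0) := by
  change (if e.word τ 0 then (e.parent τ, (-1 : ℤ)) else (e.parent τ, 0)) = _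
  split_ifs <;> rfl

theorem x1_symm_of_neg {n : ℤ} (h : n < 0) (τ : T) : e.x1.symm (τ, n) = (τ, n - 1) := by
  simp [x1, show ¬0 < n by omega, show n ≠ 0 by omega]

theorem reach_zero (τ : T) (n : ℤ) :
    Relation.ReflTransGen e.graph.Link ((τ, n) : T × ℤ) ((τ, 0) : T × ℤ) := by
  induction n using Int.induction_on with
  | zero => exact .refl
  | succ n ih =>
    refine .head ⟨0, Or.inr ?_⟩ ih
    rfl
  | pred n ih => exact .head ⟨0, Or.inl ((x0 T).apply_symm_apply ((τ, -n) : T × ℤ))⟩ ih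

theorem reach_iterate_parent (j : ℕ) (τ : T) :
    Relation.ReflTransGen e.graph.Link ((τ, 0) : T × ℤ) ((e.parent^[j] τ, 0) : T × ℤ) := by
  induction j generalizing τ with
  | zero => exact .refl
  | succ j ih =>
    have hlink : e.graph.Link ((τ, 0) : T × ℤ) (e.x1.symm (τ, 0)) :=
      ⟨1, Or.inr (e.x1.apply_symm_apply (τ, 0))⟩
    rw [x1_symm_zero] at hlink
    exact (Relation.ReflTransGen.head hlink (e.reach_zero _ _)).trans (ih (e.parent τ))

theorem graph_connected (h : ∀ τ υ, ∃ i j, e.parent^[i] τ = e.parent^[j] υ) :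
    e.graph.Connected := by
  rintro ⟨τ, m⟩ ⟨υ, n⟩
  obtain ⟨i, j, hij⟩ := h τ υ
  have hτ := (e.reach_zero τ m).trans (e.reach_iterate_parent i τ)
  have hυ := (e.reach_zero υ n).trans (e.reach_iterate_parent j υ)
  rw [hij] at hτ
  exact hτ.trans (MarkedGraph.link_symm hυ)

/-- The first `N` ancestors of `τ` do not recur among its ancestors. -/
def NoReturn (N : ℕ) (τ : T) : Prop :=
  ∀ i ≤ N, ∀ j, e.parent^[i] τ = e.parent^[j] τ → i = j

/-- The back-and-forth system behind `ballIso_of_word_eq`: from an ancestor of `τ` one goes down to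
`τ'`, from the same ancestor of `υ` one goes down by the same letters to `υ'`, and the two words are
still known to agree as far as the words of `τ` and `υ` agree on their first `N` letters. -/
def Corresponds (N : ℕ) (τ : T) (υ : T') (k : ℕ) (τ' : T) (υ' : T') : Prop :=
  ∃ i j, i + j + k ≤ N ∧ e.parent^[j] τ' = e.parent^[i] τ ∧ e'.parent^[j] υ' = e'.parent^[i] υ ∧
    ∀ a, a + i < j + N → e.word τ' a = e'.word υ' a

namespace Corresponds

variable {e e'} {N k : ℕ} {τ τ' τ'' : T} {υ υ' υ'' : T'}

theorem mono (h : Corresponds e e' N τ υ (k + 1) τ' υ') : Corresponds e e' N τ υ k τ' υ' := by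
  obtain ⟨i, j, hk, hrest⟩ := h
  exact ⟨i, j, by omega, hrest⟩

theorem swap (h : Corresponds e e' N τ υ k τ' υ') : Corresponds e' e N υ τ k υ' τ' := by
  obtain ⟨i, j, hk, hτ, hυ, hword⟩ := h
  exact ⟨i, j, hk, hυ, hτ, fun a ha => (hword a ha).symm⟩

theorem child (b : Bool) (h : Corresponds e e' N τ υ (k + 1) τ' υ') :
    Corresponds e e' N τ υ k (e.child b τ') (e'.child b υ') := by
  obtain ⟨i, j, hk, hτ, hυ, hword⟩ := h
  refine ⟨i, j + 1, by omega, by simpa using hτ, by simpa using hυ, fun a ha => ?_⟩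
  cases a with
  | zero => simp
  | succ a => simpa using hword a (by omega)

theorem parent (h : Corresponds e e' N τ υ (k + 1) τ' υ') :
    Corresponds e e' N τ υ k (e.parent τ') (e'.parent υ') := by
  obtain ⟨i, j, hk, hτ, hυ, hword⟩ := h
  cases j with
  | zero =>
    refine ⟨i + 1, 0, by omega, ?_, ?_, fun a ha => hword (a + 1) (by omega)⟩
    · rw [Function.iterate_succ_apply', ← hτ]; rfl
    · rw [Function.iterate_succ_apply', ← hυ]; rfl
  | succ j => exact ⟨i, j, by omega, hτ, hυ, fun a ha => hword (a + 1) (by omega)⟩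

theorem word_zero_eq (h : Corresponds e e' N τ υ (k + 1) τ' υ') : e.word τ' 0 = e'.word υ' 0 := by
  obtain ⟨i, j, hk, -, -, hword⟩ := h
  exact hword 0 (by omega)

theorem right_unique (hret : e.NoReturn N τ) (h : Corresponds e e' N τ υ 0 τ' υ')
    (h' : Corresponds e e' N τ υ 0 τ' υ'') : υ' = υ'' := by
  obtain ⟨i, j, hk, hτ, hυ, hword⟩ := h
  obtain ⟨i', j', hk', hτ', hυ', hword'⟩ := h'
  wlog hj : j ≤ j' generalizing i j i' j' υ' υ''
  · exact (this i' j' hk' hτ' hυ' hword' i j hk hτ hυ hword (by omega)).symm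
  obtain ⟨c, rfl⟩ := Nat.exists_eq_add_of_le' hj
  obtain rfl : i' = c + i := hret i' (by omega) (c + i) (by
    rw [← hτ', Function.iterate_add_apply, hτ, ← Function.iterate_add_apply])
  refine e'.eq_of_iterate_parent_eq (j := c + j) ?_ fun a ha =>
    (hword a (by omega)).symm.trans (hword' a (by omega))
  rw [hυ', Function.iterate_add_apply, hυ, ← Function.iterate_add_apply]

theorem backAndForth (hτ : e.NoReturn N τ) (hυ : e'.NoReturn N υ) :
    BackAndForth e.graph e'.graph fun k (p : T × ℤ) (q : T' × ℤ) =>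
      p.2 = q.2 ∧ Corresponds e e' N τ υ k p.1 q.1 := by
  refine backAndForth_ofPerm ?_ ?_ ?_ ?_
  · exact fun k p q h => ⟨h.1, h.2.mono⟩
  · rintro k s ⟨τ', n⟩ ⟨υ', _⟩ ⟨rfl, h⟩
    fin_cases s
    · exact ⟨rfl, h.mono⟩
    · change (e.x1 (τ', n)).2 = (e'.x1 (υ', n)).2 ∧
        Corresponds e e' N τ υ k (e.x1 (τ', n)).1 (e'.x1 (υ', n)).1
      obtain hn | rfl | rfl | hn : 0 < n ∨ n = 0 ∨ n = -1 ∨ n < -1 := by omega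
      · rw [x1_of_pos e hn, x1_of_pos e' hn]
        exact ⟨rfl, h.mono⟩
      · exact ⟨rfl, h.child false⟩
      · exact ⟨rfl, h.child true⟩
      · rw [x1_of_lt e hn, x1_of_lt e' hn]
        exact ⟨rfl, h.mono⟩
  · rintro k s ⟨τ', n⟩ ⟨υ', _⟩ ⟨rfl, h⟩
    fin_cases s
    · exact ⟨rfl, h.mono⟩
    · change (e.x1.symm (τ', n)).2 = (e'.x1.symm (υ', n)).2 ∧
        Corresponds e e' N τ υ k (e.x1.symm (τ', n)).1 (e'.x1.symm (υ', n)).1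
      obtain hn | rfl | hn : 0 < n ∨ n = 0 ∨ n < 0 := by omega
      · rw [x1_symm_of_pos e hn, x1_symm_of_pos e' hn]
        exact ⟨rfl, h.mono⟩
      · rw [x1_symm_zero, x1_symm_zero, h.word_zero_eq]
        exact ⟨rfl, h.parent⟩
      · rw [x1_symm_of_neg e hn, x1_symm_of_neg e' hn]
        exact ⟨rfl, h.mono⟩
  · rintro ⟨τ', n⟩ ⟨υ', _⟩ ⟨τ'', n'⟩ ⟨υ'', _⟩ ⟨rfl, h⟩ ⟨rfl, h'⟩
    simp only [Prod.mk.injEq]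
    refine and_congr_left fun _ => ⟨?_, ?_⟩
    · rintro rfl
      exact right_unique hτ h h'
    · rintro rfl
      exact right_unique hυ h.swap h'.swap

end Corresponds

variable {e e'}

theorem ballIso_of_word_eq (he : e.graph.Connected) (he' : e'.graph.Connected) {N : ℕ} {τ : T}
    {υ : T'} (hword : ∀ a ≤ N, e.word τ a = e'.word υ a) (hτ : e.NoReturn (N + 1) τ)
    (hυ : e'.NoReturn (N + 1) υ) (n : ℤ) :
    PointedGraph.BallIso N ⟨e.graph, he, ((τ, n) : T × ℤ)⟩ ⟨e'.graph, he', ((υ, n) : T' × ℤ)⟩ :=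
  PointedGraph.ballIso_of_backAndForth (Corresponds.backAndForth hτ hυ)
    ⟨rfl, 0, 0, by omega, rfl, rfl, fun a ha => hword a (by omega)⟩

theorem ballIso_line_of_lt (he : e.graph.Connected) {N : ℕ} {τ : T} {n : ℤ} (hn : N + 1 < n) :
    PointedGraph.BallIso N ⟨e.graph, he, ((τ, n) : T × ℤ)⟩
      ⟨lineGraph 0, lineGraph_connected 0, (0 : ℤ)⟩ := by
  have := ballIso_lineGraph (n := N) (d := 0) he (by simp) (f := fun j : ℤ => (τ, n + j))
    (fun i j hij => by simpa using hij) (fun j => by simp [x0_apply, add_assoc])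
    fun j hj => (e.x1_of_pos (by grind) τ).trans (by simp)
  simp only [add_zero] at this
  exact this

theorem ballIso_line_of_lt_neg (he : e.graph.Connected) {N : ℕ} {τ : T} {n : ℤ}
    (hn : n < -(N + 2)) :
    PointedGraph.BallIso N ⟨e.graph, he, ((τ, n) : T × ℤ)⟩
      ⟨lineGraph 1, lineGraph_connected 1, (0 : ℤ)⟩ := by
  have := ballIso_lineGraph (n := N) (d := 1) he (by simp) (f := fun j : ℤ => (τ, n + j))
    (fun i j hij => by simpa using hij) (fun j => by simp [x0_apply, add_assoc])
    fun j hj => (e.x1_of_lt (by grind) τ).trans (by simp [add_assoc])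
  simp only [add_zero] at this
  exact this

end Splitting

namespace Splitting

variable {T T' : Type} {e : Splitting T} {e' : Splitting T'}

/-! ### Rigidity of the graphs of binary splittings -/

theorem snd_eq_snd_of_semiconj {W : Type} {ρ : Equiv.Perm W} {P : W → Prop} {f : T × ℤ → W}
    {g : T' × ℤ → W} (hf : Function.Semiconj f (x0 T) ρ) (hg : Function.Semiconj g (x0 T') ρ)
    (hfP : ∀ p, P (f p) ↔ 0 < p.2) (hgP : ∀ q, P (g q) ↔ 0 < q.2) {p : T × ℤ} {q : T' × ℤ}
    (h : f p = g q) : p.2 = q.2 := by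
  have hpos (j : ℤ) : 0 < p.2 + j ↔ 0 < q.2 + j := by
    have hj : f ((x0 T ^ j) p) = g ((x0 T' ^ j) q) := by
      rw [semiconj_zpow hf j p, semiconj_zpow hg j q, h]
    simpa only [x0_zpow_apply, hfP, hgP] using iff_of_eq (congrArg P hj)
  have h₁ := hpos (1 - p.2)
  have h₂ := hpos (1 - q.2)
  omega

theorem x1_eq_self_iff (he : ∀ b τ, e.child b τ ≠ τ) (p : T × ℤ) : e.x1 p = p ↔ 0 < p.2 := by
  obtain ⟨τ, n⟩ := p
  obtain h | rfl | rfl | h : 0 < n ∨ n = 0 ∨ n = -1 ∨ n < -1 := by omega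
  · simp [x1_of_pos e h, h]
  · simp [x1_zero, he]
  · simp [x1_neg_one]
  · simp [x1_of_lt e h, show n ≤ 0 by omega]

section Semiconj

variable {φ : T × ℤ ≃ T' × ℤ} (h₀ : Function.Semiconj φ (x0 T) (x0 T'))
  (h₁ : Function.Semiconj φ e.x1 e'.x1)

include h₀

theorem map_shift {τ : T} {υ : T'} {m : ℤ} (h : φ (τ, m) = (υ, m)) (n : ℤ) :
    φ (τ, n) = (υ, n) := by
  have := semiconj_zpow h₀ (n - m) (τ, m)
  simpa [x0_zpow_apply, h] using this

variable (he : ∀ b τ, e.child b τ ≠ τ) (he' : ∀ b τ, e'.child b τ ≠ τ)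

include h₁ he he'

theorem snd_map (p : T × ℤ) :
    (φ p).2 = p.2 := by
  refine (snd_eq_snd_of_semiconj (P := fun q => e'.x1 q = q) (f := φ) (g := id) h₀ (fun _ => rfl)
    (fun p => ?_) (x1_eq_self_iff he') (p := p) rfl).symm
  rw [← h₁ p, φ.apply_eq_iff_eq, x1_eq_self_iff he]

theorem map_parent {τ : T} {υ : T'} (h : φ (τ, 0) = (υ, 0)) :
    e.word τ 0 = e'.word υ 0 ∧ φ (e.parent τ, 0) = (e'.parent υ, 0) := by
  have hsymm : φ (e.x1.symm (τ, 0)) = e'.x1.symm (υ, 0) := by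
    rw [h₁.inverses_right e.x1.apply_symm_apply e'.x1.symm_apply_apply (τ, 0), h]
  have hsnd := snd_map h₀ h₁ he he' (e.x1.symm (τ, 0))
  rw [hsymm, x1_symm_zero, x1_symm_zero] at hsnd
  rw [x1_symm_zero, x1_symm_zero] at hsymm
  refine ⟨?_, map_shift h₀ (hsymm.trans (Prod.ext rfl hsnd)) 0⟩
  cases hτ : e.word τ 0 <;> cases hυ : e'.word υ 0 <;> simp_all

theorem word_eq_of_map_eq {τ : T} {υ : T'} (h : φ (τ, 0) = (υ, 0)) :
    e.word τ = e'.word υ := by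
  funext j
  induction j generalizing τ υ with
  | zero => exact (map_parent h₀ h₁ he he' h).1
  | succ _ ih => exact ih (map_parent h₀ h₁ he he' h).2

end Semiconj

theorem word_eq_of_iso (he : ∀ b τ, e.child b τ ≠ τ) (he' : ∀ b τ, e'.child b τ ≠ τ)
    (hc : e.graph.Connected) (hc' : e'.graph.Connected) {τ : T} {υ : T'} {m n : ℤ}
    (h : PointedGraph.Iso ⟨e.graph, hc, ((τ, m) : T × ℤ)⟩ ⟨e'.graph, hc', ((υ, n) : T' × ℤ)⟩) :
    e.word τ = e'.word υ ∧ m = n := by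
  obtain ⟨φ, hφ, hsemi⟩ := (iso_ofPerm_iff hc hc' (τ, m) (υ, n)).1 h
  obtain rfl : n = m := by
    have hsnd := snd_map (hsemi 0) (hsemi 1) he he' (τ, m)
    rwa [hφ] at hsnd
  exact ⟨word_eq_of_map_eq (hsemi 0) (hsemi 1) he he' (map_shift (hsemi 0) hφ 0), rfl⟩

theorem not_iso_lineGraph (hc : e.graph.Connected) (p : T × ℤ) (d x : ℤ) :
    ¬PointedGraph.Iso ⟨e.graph, hc, p⟩ ⟨lineGraph d, lineGraph_connected d, x⟩ := by
  intro h
  obtain ⟨φ, -, hsemi⟩ := (iso_ofPerm_iff hc (lineGraph_connected d) p x).1 h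
  have hd (q : T × ℤ) : φ (e.x1 q) = φ q + d := hsemi 1 q
  have hloop := hd (p.1, 1)
  have hmove := hd (p.1, -2)
  rw [x1_of_pos e one_pos] at hloop
  rw [x1_of_lt e (by norm_num), left_eq_add.1 hloop, add_zero, φ.apply_eq_iff_eq] at hmove
  simp at hmove

end Splitting

theorem eq_of_iso_lineGraph {c d x y : ℤ}
    (h : PointedGraph.Iso ⟨lineGraph c, lineGraph_connected c, x⟩
      ⟨lineGraph d, lineGraph_connected d, y⟩) : c = d := by
  obtain ⟨φ, -, hsemi⟩ := (iso_ofPerm_iff (lineGraph_connected c) (lineGraph_connected d) x y).1 h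
  have h₀ : φ (0 + c) = φ 0 + c := by simpa using semiconj_zpow (hsemi 0) c 0
  have h₁ : φ (0 + c) = φ 0 + d := hsemi 1 0
  exact add_left_cancel (h₀.symm.trans h₁)

/-- The configuration around the vertex `1 / 2` of a graph of type A that tells these graphs apart
from their limits: arrows with both labels lead from some vertex (`7 / 8`) to a common vertex
(`3 / 4`), whose `x₀`-arrow leads to a vertex (`1 / 2`) with an `x₁`-loop. -/
def HasDoubleArrowBeforeLoop {V : Type} (σ : Fin 2 → Equiv.Perm V) : Prop :=
  ∃ a, σ 1 a = σ 0 a ∧ σ 1 (σ 0 (σ 0 a)) = σ 0 (σ 0 a)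

theorem HasDoubleArrowBeforeLoop.of_iso {V W : Type} {σ : Fin 2 → Equiv.Perm V}
    {ρ : Fin 2 → Equiv.Perm W} (hσ : (ofPerm σ).Connected) (hρ : (ofPerm ρ).Connected) {x : V}
    {y : W} (h : PointedGraph.Iso ⟨ofPerm σ, hσ, x⟩ ⟨ofPerm ρ, hρ, y⟩)
    (ha : HasDoubleArrowBeforeLoop σ) : HasDoubleArrowBeforeLoop ρ := by
  obtain ⟨φ, -, hsemi⟩ := (iso_ofPerm_iff hσ hρ x y).1 h
  obtain ⟨a, hdouble, hloop⟩ := ha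
  refine ⟨φ a, ?_, ?_⟩
  · rw [← hsemi, ← hsemi, hdouble]
  · rw [← hsemi, ← hsemi, ← hsemi, hloop]

theorem Splitting.hasDoubleArrowBeforeLoop {T : Type} (e : Splitting T) {τ : T}
    (h : e.child false τ = τ) : HasDoubleArrowBeforeLoop ![x0 T, e.x1] := by
  refine ⟨(τ, -2), e.x1_of_lt (by norm_num) τ, ?_⟩
  change e.x1 (τ, 0) = (τ, 0)
  rw [x1_zero, h]

theorem Splitting.not_hasDoubleArrowBeforeLoop {T : Type} {e : Splitting T}
    (he : ∀ b τ, e.child b τ ≠ τ) : ¬HasDoubleArrowBeforeLoop ![x0 T, e.x1] := by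
  rintro ⟨⟨τ, n⟩, hdouble, hloop⟩
  have hn : 0 < n + 1 + 1 := (x1_eq_self_iff he (τ, n + 1 + 1)).1 hloop
  replace hdouble : e.x1 (τ, n) = (τ, n + 1) := hdouble
  obtain rfl | rfl | hpos : n = -1 ∨ n = 0 ∨ 0 < n := by omega
  · exact he true τ (congrArg Prod.fst hdouble)
  · exact he false τ (congrArg Prod.fst hdouble)
  · simp [x1_of_pos e hpos] at hdouble

theorem not_hasDoubleArrowBeforeLoop_line (d : ℤ) :
    ¬HasDoubleArrowBeforeLoop ![Equiv.addRight 1, Equiv.addRight d] := by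
  rintro ⟨a, hdouble, hloop⟩
  replace hdouble : a + d = a + 1 := hdouble
  replace hloop : a + 1 + 1 + d = a + 1 + 1 := hloop
  omega

/-! ### Graphs of type B -/

/-- The tree of a graph of type B, split according to the first turn on the way up. By definition,
`treeGraph w` is the graph of this splitting. -/
def treeSplitting (w : ℕ → Bool) : Splitting (Tree w) where
  toFun τ := (τ.1.2 0, τ.parent)
  invFun p := p.2.child p.1
  left_inv τ := Tree.child_parent _ τ rfl
  right_inv _ := Prod.ext rfl (Tree.parent_child _ _)

theorem treeSplitting_iterate_parent_level {w : ℕ → Bool} (j : ℕ) (τ : Tree w) :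
    ((treeSplitting w).parent^[j] τ).1.1 = τ.1.1 + j := by
  induction j with
  | zero => simp
  | succ j ih =>
    rw [Function.iterate_succ_apply']
    change ((treeSplitting w).parent^[j] τ).1.1 + 1 = _
    rw [ih]
    push_cast
    ring

theorem word_treeSplitting {w : ℕ → Bool} (τ : Tree w) : (treeSplitting w).word τ = τ.1.2 := by
  funext j
  induction j generalizing τ with
  | zero => rfl
  | succ _ ih => exact ih τ.parent

theorem noReturn_treeSplitting {w : ℕ → Bool} (N : ℕ) (τ : Tree w) :
    (treeSplitting w).NoReturn N τ := by
  intro i _ j h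
  have hlevel := congrArg (fun υ : Tree w => υ.1.1) h
  simp only [treeSplitting_iterate_parent_level] at hlevel
  omega

theorem treeSplitting_child_ne {w : ℕ → Bool} (b : Bool) (τ : Tree w) :
    (treeSplitting w).child b τ ≠ τ := by
  intro h
  have hlevel : τ.1.1 - 1 = τ.1.1 := congrArg (fun υ : Tree w => υ.1.1) h
  omega

/-- The graph of type B whose base vertex has the label determined by `v` and `n`. -/
def pointedTree (v : ℕ → Bool) (n : ℤ) : PointedGraph :=
  ⟨treeGraph v, treeGraph_connected v, ((spine v 0, n) : Tree v × ℤ)⟩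

theorem word_spine_zero (v : ℕ → Bool) : (treeSplitting v).word (spine v 0) = v := by
  rw [word_treeSplitting]
  simp [spine]

theorem pointedTree_iso_iff {v v' : ℕ → Bool} {n n' : ℤ} :
    PointedGraph.Iso (pointedTree v n) (pointedTree v' n') ↔ v = v' ∧ n = n' := by
  refine ⟨fun h => ?_, fun ⟨hv, hn⟩ => hv ▸ hn ▸ .refl _⟩
  have := Splitting.word_eq_of_iso treeSplitting_child_ne treeSplitting_child_ne
    (treeGraph_connected v) (treeGraph_connected v') h
  rwa [word_spine_zero, word_spine_zero] at this

theorem typeB_eq_range :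
    typeB = Set.range fun p : (ℕ → Bool) × ℤ => GraphSpace.mk (pointedTree p.1 p.2) := by
  apply Set.Subset.antisymm
  · rintro _ ⟨w, ⟨τ, n⟩, rfl⟩
    refine ⟨(τ.1.2, n), Quotient.sound (PointedGraph.iso_of_ballIso fun N => ?_)⟩
    exact Splitting.ballIso_of_word_eq (e := treeSplitting τ.1.2) (e' := treeSplitting w)
      (treeGraph_connected _) (treeGraph_connected w) (τ := spine τ.1.2 0) (υ := τ)
      (fun a _ => by rw [word_spine_zero, word_treeSplitting])
      (noReturn_treeSplitting _ _) (noReturn_treeSplitting _ _) n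
  · rintro _ ⟨⟨v, n⟩, rfl⟩
    exact ⟨v, _, rfl⟩

/-! ### The parametrization of the limit graphs by vertex labels -/

/-- The number of equal letters in front of the first change in the label of a vertex with second
coordinate `n`. -/
def runLength (n : ℤ) : ℕ := if 0 < n then n.toNat else (1 - n).toNat

/-- The label of the vertex `(τ, n)`, where `v` is the word of `τ`: it is `0ⁿ1v` for `n > 0` and
`1¹⁻ⁿ0v` for `n ≤ 0`. -/
def label (p : (ℕ → Bool) × ℤ) (i : ℕ) : Bool :=
  if i < runLength p.2 then decide (p.2 ≤ 0)
  else if i = runLength p.2 then decide (0 < p.2) else p.1 (i - runLength p.2 - 1)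

theorem finite_setOf_runLength_le (N : ℕ) : {n | runLength n ≤ N}.Finite :=
  (Set.finite_Icc (-(N : ℤ)) N).subset fun n (hn : runLength n ≤ N) => by grind [runLength]

theorem runLength_pos (n : ℤ) : 0 < runLength n := by
  grind [runLength]

theorem label_of_lt {p : (ℕ → Bool) × ℤ} {i : ℕ} (h : i < runLength p.2) :
    label p i = decide (p.2 ≤ 0) := if_pos h

theorem label_zero (p : (ℕ → Bool) × ℤ) : label p 0 = decide (p.2 ≤ 0) :=
  label_of_lt (runLength_pos p.2)

theorem label_runLength (p : (ℕ → Bool) × ℤ) : label p (runLength p.2) = decide (0 < p.2) := by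
  simp [label]

theorem label_runLength_add (p : (ℕ → Bool) × ℤ) (i : ℕ) :
    label p (runLength p.2 + 1 + i) = p.1 i := by
  grind [label]

theorem label_eq_iff {p : (ℕ → Bool) × ℤ} {x : ℕ → Bool} :
    label p = x ↔ (∀ i < runLength p.2, x i = decide (p.2 ≤ 0)) ∧
      x (runLength p.2) = decide (0 < p.2) ∧ ∀ i, x (runLength p.2 + 1 + i) = p.1 i := by
  constructor
  · rintro rfl
    exact ⟨fun i => label_of_lt, label_runLength p, label_runLength_add p⟩
  · rintro ⟨hlt, heq, hgt⟩
    funext i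
    obtain h | rfl | h := lt_trichotomy i (runLength p.2)
    · rw [label_of_lt h, hlt i h]
    · rw [label_runLength, heq]
    · obtain ⟨j, rfl⟩ := Nat.exists_eq_add_of_le (Nat.succ_le_of_lt h)
      rw [label_runLength_add, hgt]

theorem label_runLength_ne (p : (ℕ → Bool) × ℤ) : label p (runLength p.2) ≠ label p 0 := by
  rw [label_runLength, label_zero]
  by_cases h : 0 < p.2 <;> simp [h]

theorem runLength_le_of_label_eq {p q : (ℕ → Bool) × ℤ} (h : label p = label q) :
    runLength p.2 ≤ runLength q.2 := by
  by_contra! hlt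
  refine label_runLength_ne q ?_
  rw [← h, label_of_lt hlt, label_zero]

theorem label_injective : Function.Injective label := by
  rintro ⟨v, m⟩ ⟨w, n⟩ h
  have hrun : runLength m = runLength n :=
    le_antisymm (runLength_le_of_label_eq h) (runLength_le_of_label_eq h.symm)
  have hsign := congrFun h 0
  rw [label_zero, label_zero, decide_eq_decide] at hsign
  obtain rfl : m = n := by grind [runLength]
  exact Prod.ext (funext fun i => by
    rw [← label_runLength_add (v, m), h, label_runLength_add (w, m)]) rfl

theorem exists_runLength_eq {k : ℕ} (hk : 0 < k) (c : Bool) :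
    ∃ n : ℤ, runLength n = k ∧ decide (n ≤ 0) = c := by
  cases c
  · exact ⟨k, by grind [runLength]⟩
  · exact ⟨1 - k, by grind [runLength]⟩

theorem exists_label_eq_or_eq_const (x : ℕ → Bool) :
    (∃ p, x = label p) ∨ ∃ c, x = fun _ => c := by
  classical
  by_cases h : ∃ i, x i ≠ x 0
  · left
    have hpos : 0 < Nat.find h := (Nat.find_pos h).2 (by simp)
    obtain ⟨n, hrun, hsign⟩ := exists_runLength_eq hpos (x 0)
    refine ⟨(fun i => x (Nat.find h + 1 + i), n), (label_eq_iff.2 ⟨fun i hi => ?_, ?_, ?_⟩).symm⟩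
    · rw [hrun] at hi
      exact (not_not.1 (Nat.find_min h hi)).trans hsign.symm
    · have hchange : x (Nat.find h) = !x 0 := Bool.eq_not.2 (Nat.find_spec h)
      change x (runLength n) = decide (0 < n)
      rw [hrun, hchange, ← hsign, ← decide_not]
      simp only [not_le]
    · simp only [hrun, implies_true]
  · push Not at h
    exact Or.inr ⟨x 0, funext h⟩

theorem label_ne_const (p : (ℕ → Bool) × ℤ) (c : Bool) : label p ≠ fun _ => c := fun h =>
  label_runLength_ne p (by rw [h])

theorem exists_label_eq_of_agree {p : (ℕ → Bool) × ℤ} {N : ℕ} {y : ℕ → Bool}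
    (h : ∀ i < runLength p.2 + 1 + N, y i = label p i) :
    ∃ v, y = label (v, p.2) ∧ ∀ a < N, v a = p.1 a := by
  refine ⟨fun i => y (runLength p.2 + 1 + i),
    Eq.symm (label_eq_iff.2 ⟨fun i (hi : i < runLength p.2) => ?_, ?_, fun _ => rfl⟩),
    fun a ha => (h _ (by omega)).trans (label_runLength_add p a)⟩
  · exact (h i (by omega)).trans (label_of_lt hi)
  · exact (h (runLength p.2) (by omega)).trans (label_runLength p)

theorem le_runLength_of_label_eq {p : (ℕ → Bool) × ℤ} {N : ℕ} {c : Bool}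
    (h : ∀ i < N, label p i = c) : N ≤ runLength p.2 := by
  by_contra! hlt
  exact label_runLength_ne p ((h _ hlt).trans (h 0 (by omega)).symm)

/-- The word that agrees with `x` before the position `N`, followed by `1000…`. -/
def truncate (x : ℕ → Bool) (N i : ℕ) : Bool := if i < N then x i else decide (i = N)

theorem truncate_self (x : ℕ → Bool) (N : ℕ) : truncate x N N = true := by simp [truncate]

theorem truncate_of_lt (x : ℕ → Bool) {N i : ℕ} (h : N < i) : truncate x N i = false := by
  simp [truncate, h.not_gt, h.ne']

theorem tendsto_truncate (x : ℕ → Bool) :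
    Filter.Tendsto (truncate x) Filter.atTop (nhds x) := by
  refine tendsto_pi_nhds.2 fun i => tendsto_nhds_of_eventually_eq ?_
  filter_upwards [Filter.eventually_gt_atTop i] with N hN
  exact if_pos hN

namespace GraphSpace

theorem mk_eq_mk_iff {Γ Δ : PointedGraph} : mk Γ = mk Δ ↔ Γ.Iso Δ := Quotient.eq

theorem tendsto_dist_zero_iff {ι : Type*} {l : Filter ι} {f g : ι → GraphSpace} :
    Filter.Tendsto (fun x => dist (f x) (g x)) l (nhds 0) ↔
      ∀ n, ∀ᶠ x in l, BallIso n (f x) (g x) := by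
  have hbasis : (nhds (0 : ℝ)).HasBasis (fun _ : ℕ => True)
      fun n => Metric.closedBall 0 ((1 / 2) ^ n) :=
    Metric.nhds_basis_closedBall_pow (by norm_num) (by norm_num)
  rw [hbasis.tendsto_right_iff]
  simp [← dist_le_iff]

end GraphSpace

/-- The graph of type C with black (`c = false`) or white (`c = true`) vertices. -/
def linePoint (c : Bool) : GraphSpace :=
  GraphSpace.mk ⟨lineGraph (bif c then 1 else 0), lineGraph_connected _, (0 : ℤ)⟩

/-- The graph of type B or C at whose base vertex the label is a given word, the words `000…` and
`111…` being the labels of the vertices of the graphs of type C. -/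
noncomputable def limitGraph : (ℕ → Bool) → GraphSpace :=
  Function.extend label (fun p => GraphSpace.mk (pointedTree p.1 p.2)) fun x => linePoint (x 0)

theorem limitGraph_label (p : (ℕ → Bool) × ℤ) :
    limitGraph (label p) = GraphSpace.mk (pointedTree p.1 p.2) :=
  label_injective.extend_apply _ _ p

theorem limitGraph_const (c : Bool) : limitGraph (fun _ => c) = linePoint c :=
  Function.extend_apply' _ _ _ fun ⟨p, hp⟩ => label_ne_const p c hp

theorem linePoint_injective : Function.Injective linePoint := by
  intro c d h
  have := eq_of_iso_lineGraph (GraphSpace.mk_eq_mk_iff.1 h)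
  cases c <;> cases d <;> simp_all

theorem typeC_eq_range : typeC = Set.range linePoint := by
  ext g
  simp [typeC, linePoint]

theorem range_limitGraph : Set.range limitGraph = typeB ∪ typeC := by
  rw [typeB_eq_range, typeC_eq_range]
  apply Set.Subset.antisymm
  · rintro _ ⟨x, rfl⟩
    obtain ⟨p, rfl⟩ | ⟨c, rfl⟩ := exists_label_eq_or_eq_const x
    · exact Or.inl ⟨p, (limitGraph_label p).symm⟩
    · exact Or.inr ⟨c, (limitGraph_const c).symm⟩
  · rintro _ (⟨p, rfl⟩ | ⟨c, rfl⟩)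
    · exact ⟨_, limitGraph_label p⟩
    · exact ⟨_, limitGraph_const c⟩

theorem mk_pointedTree_ne_linePoint (v : ℕ → Bool) (n : ℤ) (c : Bool) :
    GraphSpace.mk (pointedTree v n) ≠ linePoint c := fun h =>
  Splitting.not_iso_lineGraph (e := treeSplitting v) (treeGraph_connected v) _ _ _
    (GraphSpace.mk_eq_mk_iff.1 h)

theorem limitGraph_injective : Function.Injective limitGraph := by
  intro x y h
  obtain ⟨p, rfl⟩ | ⟨c, rfl⟩ := exists_label_eq_or_eq_const x <;>
    obtain ⟨q, rfl⟩ | ⟨d, rfl⟩ := exists_label_eq_or_eq_const y <;>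
    simp only [limitGraph_label, limitGraph_const] at h
  · obtain ⟨hv, hn⟩ := pointedTree_iso_iff.1 (GraphSpace.mk_eq_mk_iff.1 h)
    rw [Prod.ext hv hn]
  · exact absurd h (mk_pointedTree_ne_linePoint _ _ _)
  · exact absurd h.symm (mk_pointedTree_ne_linePoint _ _ _)
  · rw [linePoint_injective h]

theorem ballIso_linePoint_of_lt_runLength {T : Type} {e : Splitting T} (he : e.graph.Connected)
    (τ : T) {N : ℕ} {n : ℤ} (hn : N + 3 < runLength n) :
    GraphSpace.BallIso N (GraphSpace.mk ⟨e.graph, he, ((τ, n) : T × ℤ)⟩)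
      (linePoint (decide (n ≤ 0))) := by
  rw [runLength] at hn
  by_cases hpos : 0 < n
  · rw [decide_eq_false (not_le.2 hpos)]
    exact Splitting.ballIso_line_of_lt he (by grind)
  · rw [decide_eq_true (not_lt.1 hpos)]
    exact Splitting.ballIso_line_of_lt_neg he (by grind)

theorem exists_ballIso_limitGraph (x : ℕ → Bool) (N : ℕ) :
    ∃ M, ∀ y, (∀ i < M, y i = x i) → GraphSpace.BallIso N (limitGraph y) (limitGraph x) := by
  obtain ⟨⟨v, n⟩, rfl⟩ | ⟨c, rfl⟩ := exists_label_eq_or_eq_const x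
  · refine ⟨runLength n + 1 + (N + 1), fun y hy => ?_⟩
    obtain ⟨w, rfl, hw⟩ := exists_label_eq_of_agree (p := (v, n)) hy
    rw [limitGraph_label, limitGraph_label]
    exact Splitting.ballIso_of_word_eq (e := treeSplitting w) (e' := treeSplitting v)
      (treeGraph_connected w) (treeGraph_connected v)
      (fun a ha => by rw [word_spine_zero, word_spine_zero, hw a (by omega)])
      (noReturn_treeSplitting _ _) (noReturn_treeSplitting _ _) n
  · refine ⟨N + 4, fun y hy => ?_⟩
    obtain ⟨⟨v, n⟩, rfl⟩ | ⟨d, rfl⟩ := exists_label_eq_or_eq_const y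
    · have hrun := le_runLength_of_label_eq hy
      obtain rfl : decide (n ≤ 0) = c := (label_zero (v, n)).symm.trans (hy 0 (by omega))
      rw [limitGraph_label, limitGraph_const]
      exact ballIso_linePoint_of_lt_runLength (e := treeSplitting v) (treeGraph_connected v)
        (spine v 0) hrun
    · rw [show d = c from hy 0 (by omega)]
      exact .refl _ _

theorem eventually_agree (x : ℕ → Bool) (N : ℕ) : ∀ᶠ y in nhds x, ∀ i < N, y i = x i :=
  (Set.finite_lt_nat N).eventually_all.2 fun i _ =>
    (continuous_apply i).continuousAt.eventually_mem (by simp : {x i} ∈ nhds (x i))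

theorem limitGraph_continuous : Continuous limitGraph := by
  refine continuous_iff_continuousAt.2 fun x => tendsto_iff_dist_tendsto_zero.2 ?_
  refine GraphSpace.tendsto_dist_zero_iff.2 fun N => ?_
  obtain ⟨M, hM⟩ := exists_ballIso_limitGraph x N
  exact (eventually_agree x M).mono hM

theorem limitGraph_isClosedEmbedding : Topology.IsClosedEmbedding limitGraph :=
  limitGraph_continuous.isClosedEmbedding limitGraph_injective

theorem preperfect_range_limitGraph : Preperfect (Set.range limitGraph) :=
  have := perfectSpace_pi (ι := ℕ) (X := fun _ => Bool)
  preperfect_range limitGraph_continuous limitGraph_injective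

namespace Splitting

variable {T : Type} {e : Splitting T} {o : T}

/-! ### Rooted splittings -/

theorem finite_preimage_parent (e : Splitting T) {S : Set T} (hS : S.Finite) :
    (e.parent ⁻¹' S).Finite := by
  have : e.parent ⁻¹' S = e ⁻¹' (Set.univ ×ˢ S) := by ext; simp [parent]
  rw [this]
  exact (Set.finite_univ.prod hS).preimage e.injective.injOn

theorem finite_setOf_iterate_parent_eq (e : Splitting T) (o : T) (j : ℕ) :
    {τ | e.parent^[j] τ = o}.Finite := by
  induction j with
  | zero => exact Set.finite_singleton o
  | succ j ih => exact e.finite_preimage_parent ih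

/-- Every path going up in the splitting ends at `o`, which is its own parent, with the letter `0`.
This is the shape of the tree behind the graphs of type A. -/
structure IsRootedAt (e : Splitting T) (o : T) : Prop where
  child_false : e.child false o = o
  exists_iterate_parent_eq : ∀ τ, ∃ j, e.parent^[j] τ = o

namespace IsRootedAt

variable (h : e.IsRootedAt o)

include h

theorem iterate_parent_root (j : ℕ) : e.parent^[j] o = o :=
  Function.iterate_fixed (by rw [← h.child_false, parent_child, h.child_false]) j

theorem word_root (j : ℕ) : e.word o j = false := by
  rw [word, h.iterate_parent_root, ← h.child_false]
  simp [child]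

theorem iterate_parent_eq_root_of_le {i j : ℕ} (hij : i ≤ j) {τ : T} (hi : e.parent^[i] τ = o) :
    e.parent^[j] τ = o := by
  rw [← Nat.sub_add_cancel hij, Function.iterate_add_apply, hi, h.iterate_parent_root]

theorem graph_connected : e.graph.Connected :=
  Splitting.graph_connected e fun τ υ => by
    obtain ⟨i, hi⟩ := h.exists_iterate_parent_eq τ
    obtain ⟨j, hj⟩ := h.exists_iterate_parent_eq υ
    exact ⟨i, j, hi.trans hj.symm⟩

theorem eq_root_of_isPeriodicPt {k : ℕ} (hk : 0 < k) {τ : T}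
    (hτ : Function.IsPeriodicPt e.parent k τ) : τ = o := by
  obtain ⟨j, hj⟩ := h.exists_iterate_parent_eq τ
  rw [← (hτ.mul_const j).eq]
  exact h.iterate_parent_eq_root_of_le (Nat.le_mul_of_pos_left j hk) hj

theorem noReturn {N : ℕ} {τ : T} (hτ : e.parent^[N] τ ≠ o) : e.NoReturn N τ := by
  have hne {i j : ℕ} (hi : i ≤ N) (hij : i < j) : e.parent^[i] τ ≠ e.parent^[j] τ := by
    intro heq
    refine hτ (h.iterate_parent_eq_root_of_le hi
      (h.eq_root_of_isPeriodicPt (k := j - i) (by omega) ?_))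
    rw [Function.IsPeriodicPt, Function.IsFixedPt, ← Function.iterate_add_apply,
      Nat.sub_add_cancel hij.le, heq]
  intro i hi j heq
  obtain hij | rfl | hji := lt_trichotomy i j
  · exact absurd heq (hne hi hij)
  · rfl
  · exact absurd heq.symm (hne (by omega) hji)

theorem exists_word_eq {v : ℕ → Bool} {N : ℕ} (hv : ∀ i ≥ N, v i = false) :
    ∃ τ, e.word τ = v := by
  induction N generalizing v with
  | zero => exact ⟨o, funext fun i => by rw [h.word_root, hv i (Nat.zero_le i)]⟩
  | succ N ih =>
    obtain ⟨τ, hτ⟩ := ih (v := fun i => v (i + 1)) fun i hi => hv (i + 1) (by omega)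
    refine ⟨e.child (v 0) τ, funext fun i => ?_⟩
    cases i with
    | zero => simp
    | succ i => rw [word_child_succ, hτ]

/-- The graph of a rooted splitting, with base `p`. -/
def pointed (p : T × ℤ) : GraphSpace := GraphSpace.mk ⟨e.graph, h.graph_connected, p⟩

theorem pointed_notMem_range_limitGraph (p : T × ℤ) : h.pointed p ∉ Set.range limitGraph := by
  have hconfig := e.hasDoubleArrowBeforeLoop h.child_false
  rintro ⟨x, hx⟩
  obtain ⟨⟨v, n⟩, rfl⟩ | ⟨c, rfl⟩ := exists_label_eq_or_eq_const x
  · rw [limitGraph_label] at hx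
    exact not_hasDoubleArrowBeforeLoop treeSplitting_child_ne (hconfig.of_iso h.graph_connected
      (treeGraph_connected v) (GraphSpace.mk_eq_mk_iff.1 hx).symm)
  · rw [limitGraph_const] at hx
    exact not_hasDoubleArrowBeforeLoop_line _ (hconfig.of_iso h.graph_connected
      (lineGraph_connected _) (GraphSpace.mk_eq_mk_iff.1 hx).symm)

theorem ballIso_pointed_tree {N : ℕ} {τ : T} (hτ : e.parent^[N + 1] τ ≠ o) (n : ℤ) :
    GraphSpace.BallIso N (h.pointed (τ, n)) (GraphSpace.mk (pointedTree (e.word τ) n)) :=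
  ballIso_of_word_eq (e' := treeSplitting (e.word τ)) h.graph_connected (treeGraph_connected _)
    (fun a _ => by rw [word_spine_zero]) (h.noReturn hτ) (noReturn_treeSplitting _ _) n

theorem ballIso_pointed_limitGraph {N : ℕ} {τ : T} {n : ℤ}
    (hp : e.parent^[N + 1] τ = o → N + 3 < runLength n) :
    GraphSpace.BallIso N (h.pointed (τ, n)) (limitGraph (label (e.word τ, n))) := by
  rw [limitGraph_label]
  by_cases hτ : e.parent^[N + 1] τ = o
  · exact (ballIso_linePoint_of_lt_runLength h.graph_connected τ (hp hτ)).trans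
      (ballIso_linePoint_of_lt_runLength (e := treeSplitting (e.word τ)) (treeGraph_connected _)
        (spine _ 0) (hp hτ)).symm
  · exact h.ballIso_pointed_tree hτ n

theorem tendsto_dist_pointed_limitGraph :
    Filter.Tendsto (fun p : T × ℤ => dist (h.pointed p) (limitGraph (label (e.word p.1, p.2))))
      Filter.cofinite (nhds 0) := by
  refine GraphSpace.tendsto_dist_zero_iff.2 fun N => Filter.eventually_cofinite.2 ?_
  refine ((e.finite_setOf_iterate_parent_eq o (N + 1)).prod
    (finite_setOf_runLength_le (N + 3))).subset ?_
  rintro ⟨τ, n⟩ hp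
  contrapose! hp
  exact not_not.2 (h.ballIso_pointed_limitGraph fun hτ => not_le.1 fun hn => hp ⟨hτ, hn⟩)

theorem denseRange_label : DenseRange fun p : T × ℤ => label (e.word p.1, p.2) := by
  intro x
  refine mem_closure_of_tendsto (tendsto_truncate x) (.of_forall fun N => ?_)
  obtain ⟨⟨v, n⟩, hv⟩ | ⟨c, hc⟩ := exists_label_eq_or_eq_const (truncate x N)
  · obtain ⟨τ, rfl⟩ := h.exists_word_eq (v := v) (N := N + 1) fun i hi => by
      have := congrFun hv (runLength n + 1 + i)
      rw [label_runLength_add (v, n)] at this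
      exact this.symm.trans (truncate_of_lt x (by omega))
    exact ⟨(τ, n), hv.symm⟩
  · have htrue := congrFun hc N
    have hfalse := congrFun hc (N + 1)
    rw [truncate_self] at htrue
    rw [truncate_of_lt x N.lt_succ_self, ← htrue] at hfalse
    simp at hfalse

theorem derivedSet_range_pointed : derivedSet (Set.range h.pointed) = Set.range limitGraph := by
  refine derivedSet_range_eq_of_tendsto_dist h.tendsto_dist_pointed_limitGraph ?_
    preperfect_range_limitGraph h.pointed_notMem_range_limitGraph
  rw [Set.range_comp' limitGraph, limitGraph_isClosedEmbedding.closure_image_eq,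
    h.denseRange_label.closure_range, Set.image_univ]

end IsRootedAt
end Splitting

/-! ### Graphs of type A -/

/-- The dyadic rationals of `[0, 1)`. Their binary expansions are the words whose letters are
eventually `0`. -/
abbrev DyadicIco : Type := {t : ℝ // IsDyadic t ∧ 0 ≤ t ∧ t < 1}

namespace DyadicIco

instance : Zero DyadicIco := ⟨0, .zero, le_rfl, one_pos⟩

@[simp]
theorem coe_zero : ((0 : DyadicIco) : ℝ) = 0 := rfl

/-- The splitting of `[0, 1)` into its halves: the letter of `t` is its first binary digit, and its
parent is read off the remaining digits. -/
noncomputable def splitting : Splitting DyadicIco where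
  toFun t := (decide (1 / 2 ≤ t.1), ⟨2 * t.1 - if 1 / 2 ≤ t.1 then 1 else 0, by
    obtain ⟨t, ht, h₀, h₁⟩ := t
    have hdouble : IsDyadic (2 * t) := by simpa using ht.zpow_mul 1
    split_ifs
    · exact ⟨hdouble.sub ⟨1, 0, by simp⟩, by linarith, by linarith⟩
    · exact ⟨hdouble.sub .zero, by linarith, by linarith⟩⟩)
  invFun p := ⟨((if p.1 then 1 else 0) + p.2.1) / 2, by
    obtain ⟨b, t, ht, h₀, h₁⟩ := p
    have hhalf {s : ℝ} (hs : IsDyadic s) : IsDyadic (s / 2) := by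
      simpa [div_eq_inv_mul] using hs.zpow_mul (-1)
    split_ifs
    · exact ⟨hhalf (.add ⟨1, 0, by simp⟩ ht), by linarith, by linarith⟩
    · exact ⟨hhalf (.add .zero ht), by linarith, by linarith⟩⟩
  left_inv t := Subtype.ext (by simp)
  right_inv := by
    rintro ⟨b, t, ht, h₀, h₁⟩
    cases b
    · have hlt : ¬1 / 2 ≤ (0 + t) / 2 := by linarith
      refine Prod.ext (decide_eq_false hlt) (Subtype.ext ?_)
      change 2 * ((0 + t) / 2) - (if 1 / 2 ≤ (0 + t) / 2 then 1 else 0) = t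
      rw [if_neg hlt]
      ring
    · have hle : 1 / 2 ≤ (1 + t) / 2 := by linarith
      refine Prod.ext (decide_eq_true hle) (Subtype.ext ?_)
      change 2 * ((1 + t) / 2) - (if 1 / 2 ≤ (1 + t) / 2 then 1 else 0) = t
      rw [if_pos hle]
      ring

theorem coe_child (b : Bool) (t : DyadicIco) :
    (splitting.child b t : ℝ) = ((if b then 1 else 0) + t.1) / 2 := rfl

theorem coe_parent (t : DyadicIco) :
    (splitting.parent t : ℝ) = 2 * t.1 - if 1 / 2 ≤ t.1 then 1 else 0 := rfl

theorem iterate_parent_eq_zero {m : ℕ} {t : DyadicIco} {k : ℤ} (h : t.1 * 2 ^ m = k) :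
    splitting.parent^[m] t = 0 := by
  induction m generalizing t k with
  | zero =>
    obtain ⟨t, ht, h₀, h₁⟩ := t
    obtain rfl : t = k := by simpa using h
    have hk : k = 0 := by
      have : 0 ≤ k := by exact_mod_cast h₀
      have : k < 1 := by exact_mod_cast h₁
      omega
    exact Subtype.ext (by simpa using hk)
  | succ m ih =>
    refine ih (k := k - if 1 / 2 ≤ t.1 then 2 ^ m else 0) ?_
    rw [coe_parent]
    push_cast
    rw [← h]
    split_ifs <;> ring

theorem splitting_isRootedAt : splitting.IsRootedAt 0 where
  child_false := Subtype.ext (by simp [coe_child])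
  exists_iterate_parent_eq t := by
    obtain ⟨k, m, hk⟩ := t.2.1
    exact ⟨m, iterate_parent_eq_zero (k := k) (by rw [hk]; field_simp)⟩

end DyadicIco

/-- The point of `(0, 1)` with binary expansion `0ⁿ1v` for `n > 0` and `1¹⁻ⁿ0v` for `n ≤ 0`, where
`v` is the binary expansion of `t`. -/
noncomputable def position (t : ℝ) (n : ℤ) : ℝ :=
  if 0 < n then 2 ^ (-n - 1) * (1 + t) else 1 - 2 ^ (n - 2) * (2 - t)

section position

variable {t : ℝ} {n : ℤ}

theorem position_of_pos (h : 0 < n) : position t n = 2 ^ (-n - 1) * (1 + t) := if_pos h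

theorem position_of_nonpos (h : n ≤ 0) : position t n = 1 - 2 ^ (n - 2) * (2 - t) :=
  if_neg h.not_gt

theorem position_zero : position t 0 = 1 / 2 + t / 4 := by
  rw [position_of_nonpos le_rfl]
  norm_num
  ring

theorem position_neg_one : position t (-1) = 3 / 4 + t / 8 := by
  rw [position_of_nonpos (by norm_num)]
  norm_num
  ring

theorem position_add_one_of_pos (h : 0 < n) : position t (n + 1) = position t n / 2 := by
  rw [position_of_pos h, position_of_pos (by omega), show -(n + 1) - 1 = -n - 1 - 1 by ring,
    zpow_sub_one₀ two_ne_zero (-n - 1)]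
  ring

theorem position_add_one_of_neg (h : n < 0) : position t (n + 1) = 2 * position t n - 1 := by
  rw [position_of_nonpos h.le, position_of_nonpos (by omega), show n + 1 - 2 = n - 2 + 1 by ring,
    zpow_add_one₀ two_ne_zero]
  ring

theorem position_lt_half (ht : t < 1) (h : 0 < n) : position t n < 1 / 2 := by
  have hpow : (2 : ℝ) ^ (-n - 1) ≤ 2 ^ (-2 : ℤ) := zpow_le_zpow_right₀ one_le_two (by omega)
  rw [position_of_pos h]
  norm_num at hpow
  nlinarith [zpow_pos (two_pos (α := ℝ)) (-n - 1)]

theorem le_position (ht : 0 ≤ t) {m : ℤ} (hm : m ≤ 0) (h : n ≤ m) :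
    1 - 2 ^ (m - 1) ≤ position t n := by
  have hpow : (2 : ℝ) ^ (n - 2) * 2 ≤ 2 ^ (m - 1) := by
    rw [← zpow_add_one₀ two_ne_zero]
    exact zpow_le_zpow_right₀ one_le_two (by omega)
  rw [position_of_nonpos (h.trans hm)]
  nlinarith [zpow_pos (two_pos (α := ℝ)) (n - 2)]

theorem half_le_position (ht : 0 ≤ t) (h : n ≤ 0) : 1 / 2 ≤ position t n := by
  have := le_position ht le_rfl h
  norm_num at this ⊢
  exact this

theorem position_lt_half_iff (h₀ : 0 ≤ t) (h₁ : t < 1) : position t n < 1 / 2 ↔ 0 < n :=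
  ⟨fun h => not_le.1 fun hn => h.not_ge (half_le_position h₀ hn), position_lt_half h₁⟩

theorem position_mem_unitInterval (h₀ : 0 ≤ t) (h₁ : t < 1) : position t n ∈ unitInterval := by
  obtain hn | hn := lt_or_ge 0 n
  · refine ⟨?_, (position_lt_half h₁ hn).le.trans (by norm_num)⟩
    rw [position_of_pos hn]
    positivity
  · refine ⟨(half_le_position h₀ hn).trans' (by norm_num), ?_⟩
    rw [position_of_nonpos hn]
    nlinarith [zpow_pos (two_pos (α := ℝ)) (n - 2)]

theorem position_injective (n : ℤ) : Function.Injective fun t => position t n := by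
  intro s t h
  obtain hn | hn := lt_or_ge 0 n
  · simpa [position_of_pos hn, zpow_ne_zero] using h
  · simpa [position_of_nonpos hn, zpow_ne_zero] using h

theorem x0Fun_position (h₀ : 0 ≤ t) (h₁ : t < 1) : x0Fun (position t n) = position t (n + 1) := by
  obtain hn | rfl | hn := lt_trichotomy n 0
  · have := le_position h₀ (by norm_num) (show n ≤ -1 by omega)
    norm_num at this
    rw [position_add_one_of_neg hn, x0Fun]
    split_ifs <;> linarith
  · rw [position_zero, position_of_pos (by norm_num), x0Fun]
    norm_num
    split_ifs <;> linarith
  · rw [position_add_one_of_pos hn, x0Fun, if_pos (position_lt_half h₁ hn).le]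

theorem x1Fun_position_of_pos (ht : t < 1) (hn : 0 < n) :
    x1Fun (position t n) = position t n := if_pos (position_lt_half ht hn).le

theorem x1Fun_position_zero (h₀ : 0 ≤ t) (h₁ : t < 1) :
    x1Fun (position t 0) = position (t / 2) 0 := by
  rw [position_zero, position_zero, x1Fun]
  split_ifs <;> linarith

theorem x1Fun_position_neg_one (h₀ : 0 ≤ t) (h₁ : t < 1) :
    x1Fun (position t (-1)) = position ((1 + t) / 2) 0 := by
  rw [position_zero, position_neg_one, x1Fun]
  split_ifs <;> linarith

theorem x1Fun_position_of_lt (ht : 0 ≤ t) (hn : n < -1) :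
    x1Fun (position t n) = position t (n + 1) := by
  have := le_position ht (by norm_num) (show n ≤ -2 by omega)
  norm_num at this
  rw [position_add_one_of_neg (by omega), x1Fun]
  split_ifs <;> linarith

end position

namespace DyadicIco

/-- The vertex of the Schreier graph with coordinates `(t, n)`, as a point of `[0, 1]`. -/
noncomputable def point (p : DyadicIco × ℤ) : unitInterval :=
  ⟨position p.1 p.2, position_mem_unitInterval p.1.2.2.1 p.1.2.2.2⟩

theorem point_x0 (p : DyadicIco × ℤ) : point (Splitting.x0 DyadicIco p) = x0Iso (point p) :=
  Subtype.ext ((x0Iso_apply _).trans (x0Fun_position p.1.2.2.1 p.1.2.2.2)).symm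

theorem point_x1 (p : DyadicIco × ℤ) : point (splitting.x1 p) = x1Iso (point p) := by
  refine Subtype.ext (Eq.symm ((x1Iso_apply _).trans ?_))
  obtain ⟨t, n⟩ := p
  obtain ⟨-, h₀, h₁⟩ := t.2
  change x1Fun (position t n) = position (splitting.x1 (t, n)).1 (splitting.x1 (t, n)).2
  obtain hn | rfl | rfl | hn : 0 < n ∨ n = 0 ∨ n = -1 ∨ n < -1 := by omega
  · rw [splitting.x1_of_pos hn, x1Fun_position_of_pos h₁ hn]
  · simp [Splitting.x1_zero, coe_child, x1Fun_position_zero h₀ h₁]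
  · simp [Splitting.x1_neg_one, coe_child, x1Fun_position_neg_one h₀ h₁]
  · rw [splitting.x1_of_lt hn, x1Fun_position_of_lt h₀ hn]

theorem point_arrow (s : Fin 2) (p : DyadicIco × ℤ) :
    point (![Splitting.x0 DyadicIco, splitting.x1] s p) = gen s • point p := by
  fin_cases s
  · exact point_x0 p
  · exact point_x1 p

theorem point_injective : Function.Injective point := by
  intro p q h
  have hiff (p : DyadicIco × ℤ) : (point p : ℝ) < 1 / 2 ↔ 0 < p.2 :=
    position_lt_half_iff p.1.2.2.1 p.1.2.2.2
  have hsnd := Splitting.snd_eq_snd_of_semiconj (ρ := x0Iso.toEquiv) point_x0 point_x0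
    (P := fun t => (t : ℝ) < 1 / 2) hiff hiff h
  refine Prod.ext (Subtype.ext (position_injective p.2 ?_)) hsnd
  have hposition : position p.1 p.2 = position q.1 q.2 := congrArg Subtype.val h
  rwa [← hsnd] at hposition

theorem point_zero : point (0, 0) = half :=
  Subtype.ext (position_zero.trans (by simp [half]))

theorem point_mem_orbit (p : DyadicIco × ℤ) : point p ∈ MulAction.orbit thompsonF half := by
  have hreach := splitting_isRootedAt.graph_connected ((0, 0) : DyadicIco × ℤ) p
  induction hreach with
  | refl => exact MulAction.mem_orbit_iff.2 ⟨1, (one_smul _ _).trans point_zero.symm⟩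
  | @tail q p _ hlink ih =>
    obtain ⟨s, hs | hs⟩ := hlink
    · rw [← hs]
      exact (point_arrow s q).symm ▸ MulAction.mem_orbit_of_mem_orbit (gen s) ih
    · replace ih : point (![Splitting.x0 DyadicIco, splitting.x1] s p) ∈
          MulAction.orbit thompsonF half := hs.symm ▸ ih
      rw [point_arrow] at ih
      simpa using MulAction.mem_orbit_of_mem_orbit (gen s)⁻¹ ih

/-- The vertex of the Schreier graph of the orbit of `1 / 2` with coordinates `(t, n)`. -/
noncomputable def vertex (p : DyadicIco × ℤ) : dyadicGraph.V := ⟨point p, point_mem_orbit p⟩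

theorem vertex_injective : Function.Injective vertex := fun _ _ h =>
  point_injective (congrArg Subtype.val h)

theorem adj_vertex (s : Fin 2) (p q : DyadicIco × ℤ) (h : splitting.graph.adj s p q) :
    dyadicGraph.adj s (vertex p) (vertex q) := by
  rw [← show _ = q from h]
  exact Subtype.ext (point_arrow s p).symm

end DyadicIco

theorem typeA_eq_range : typeA = Set.range DyadicIco.splitting_isRootedAt.pointed := by
  have hiso (p : DyadicIco × ℤ) :
      DyadicIco.splitting_isRootedAt.pointed p =
        GraphSpace.mk ⟨dyadicGraph, dyadicGraph_connected, DyadicIco.vertex p⟩ :=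
    Quotient.sound (PointedGraph.iso_of_injective DyadicIco.vertex DyadicIco.vertex_injective rfl
      DyadicIco.adj_vertex)
  apply Set.Subset.antisymm
  · rintro _ ⟨q, rfl⟩
    obtain ⟨p, rfl⟩ := surjective_of_map_adj (G := DyadicIco.splitting.graph)
      ((0, 0) : DyadicIco × ℤ) dyadicGraph_connected DyadicIco.vertex DyadicIco.adj_vertex q
    exact ⟨p, hiso p⟩
  · rintro _ ⟨p, rfl⟩
    exact ⟨_, hiso p⟩

theorem derivedSet_typeA : derivedSet typeA = Set.range limitGraph := by
  rw [typeA_eq_range, DyadicIco.splitting_isRootedAt.derivedSet_range_pointed]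

theorem not_typeA_subset_derivedSet : ¬typeA ⊆ derivedSet typeA := by
  rw [derivedSet_typeA, typeA_eq_range]
  exact fun h => DyadicIco.splitting_isRootedAt.pointed_notMem_range_limitGraph (0, 0)
    (h (Set.mem_range_self _))

end SchreierF

theorem mainTheorem4 :
    SchreierF.cantorBendixsonRank (closure SchreierF.typeA) = 1 ∧
    CantorBendixson.perfectKernel (closure SchreierF.typeA) = SchreierF.typeB ∪ SchreierF.typeC ∧
    Nonempty (CantorBendixson.perfectKernel (closure SchreierF.typeA) ≃ₜ (ℕ → Bool)) := by
  have hderived := SchreierF.derivedSet_typeA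
  have hperfect : Preperfect (derivedSet SchreierF.typeA) :=
    hderived ▸ SchreierF.preperfect_range_limitGraph
  have hkernel : CantorBendixson.perfectKernel (closure SchreierF.typeA) =
      Set.range SchreierF.limitGraph :=
    (SchreierF.perfectKernel_closure hperfect).trans hderived
  refine ⟨SchreierF.cantorBendixsonRank_closure hperfect SchreierF.not_typeA_subset_derivedSet,
    hkernel.trans SchreierF.range_limitGraph, ?_⟩
  rw [hkernel]
  exact ⟨SchreierF.limitGraph_isClosedEmbedding.isEmbedding.toHomeomorph.symm⟩
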